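/- Let $\mathbb{Q}[t]$ be the field with $t^2=-1$ and let $\mathbb{Q}[t](v)$ be the field of rational functions over it in an indeterminate $v$. Put $[\lambda]_v=\frac{v^{\lambda}-v^{-\lambda}}{v-v^{-1}}$, $[n]_v^!=\prod_{j=1}^n[j]_v$, and let $p(\lambda)=0$ for even $\lambda$, $p(\lambda)=1$ for odd $\lambda$. For $s\in\mathbb{Q}[t](v)$ and a family $(c_\lambda)_{\lambda\in\mathbb{Z}}$ in $\mathbb{Q}[t](v)$, let $\dot{\mathbf U}(s,c)$ be the associative $\mathbb{Q}[t](v)$-algebra without unit generated by $1_\lambda$, $E_{\lambda,\lambda-2}$, $F_{\lambda,\lambda+2}$ ($\lambda\in\mathbb{Z}$) subject to the relations $$1_\lambda 1_{\lambda'}=\delta_{\lambda,\lambda'}1_\lambda,\quad E_{\lambda,\lambda-2}1_{\lambda'}=\delta_{\lambda-2,\lambda'}E_{\lambda,\lambda-2},\quad 1_{\lambda'}E_{\lambda,\lambda-2}=\delta_{\lambda',\lambda}E_{\lambda,\lambda-2},$$ $$F_{\lambda,\lambda+2}1_{\lambda'}=\delta_{\lambda+2,\lambda'}F_{\lambda,\lambda+2},\quad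 1_{\lambda'}F_{\lambda,\lambda+2}=\delta_{\lambda',\lambda}F_{\lambda,\lambda+2},$$ $$E_{\lambda,\lambda-2}F_{\lambda-2,\lambda}-s\,F_{\lambda,\lambda+2}E_{\lambda+2,\lambda}=c_\lambda 1_\lambda .$$ Lusztig's modified quantum $\mathfrak{sl}(2)$, written $\dot{\mathbf U}(\mathfrak{sl}(2))$ with generators $\widetilde 1_\lambda,\widetilde E_{\lambda,\lambda-2},\widetilde F_{\lambda,\lambda+2}$, is the case $s=1$, $c_\lambda=[\lambda]_v$. The modified quantum $\mathfrak{osp}(1|2)$, written $\dot{\mathbf U}$, is the case $s=t^2$, $c_\lambda=t^{-\lambda-p(\lambda)}[\lambda]_v$. Clark and Wang's modified quantum $\mathfrak{osp}(1|2)$ over $\mathbb{Q}[t](v)$ is the case $s=\pi$, $c_\lambda=\frac{(\pi q)^\lambda-q^{-\lambda}}{\pi q-q^{-1}}$ with $\pi=-1$ and $q=vt^{-1}$. (a) The assignments $\widetilde E_{\lambda,\lambda-2}\mapsto t^{\lambda+p(\lambda)}E_{\lambda,\lambda-2}$, $\widetilde F_{\lambda,\lambda+2}\mapsto F_{\lambda,\lambda+2}$,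 $\widetilde 1_\lambda\mapsto 1_\lambda$ ($\lambda\in\mathbb{Z}$) extend to a unique homomorphism of $\mathbb{Q}[t](v)$-algebras $\varphi:\dot{\mathbf U}(\mathfrak{sl}(2))\to\dot{\mathbf U}$, and $\varphi$ is an isomorphism. (b) $\dot{\mathbf U}$ is isomorphic, as a $\mathbb{Q}[t](v)$-algebra, to Clark and Wang's modified quantum $\mathfrak{osp}(1|2)$. (c) $\dot{\mathbf U}$ has a basis over $\mathbb{Q}[t](v)$ whose structure constants lie in $\mathbb{N}[v,v^{-1}]$, namely the image under $\varphi$ of the canonical basis of $\dot{\mathbf U}(\mathfrak{sl}(2))$, which is the set of all $\widetilde E^{(a)}\widetilde 1_{-n}\widetilde F^{(b)}$ and $\widetilde F^{(b)}\widetilde 1_{n}\widetilde E^{(a)}$ with $a,b,n\in\mathbb{N}$ and $n\ge a+b$. Here $\widetilde E^{(a)}\widetilde 1_{\lambda}$ is the product $\widetilde E_{\lambda+2a,\lambda+2a-2}\cdots\widetilde E_{\lambda+2,\lambda}$ divided by $[a]_v^!$ (and $\widetilde 1_\lambda$ if $a=0$), and similarly for $\widetilde 1_{\lambda}\widetilde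 E^{(a)}$, $\widetilde F^{(b)}\widetilde 1_{\lambda}$ and $\widetilde 1_{\lambda}\widetilde F^{(b)}$. -/

import Mathlib

noncomputable section

namespace ModifiedQuantum

/-! ### Associative algebras without unit, presented by generators and relations -/

section Presentation

variable (k : Type) [Field k] (X : Type)

/-- The free associative `k`-algebra without unit on a set `X`: finite `k`-linear combinations
of nonempty words in `X`, multiplied by concatenation. -/
abbrev FreeNonUnital : Type := MonoidAlgebra k (FreeSemigroup X)

variable {k X}

/-- A generator, as an element of the free algebra without unit. -/
def FreeNonUnital.gen (x : X) : FreeNonUnital k X := MonoidAlgebra.single (FreeSemigroup.of x) 1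

/-- All scalar multiples of the relations in `r`. -/
inductive ScalarMultiples (r : FreeNonUnital k X → FreeNonUnital k X → Prop) :
    FreeNonUnital k X → FreeNonUnital k X → Prop
  | smul (c : k) {x y : FreeNonUnital k X} : r x y → ScalarMultiples r (c • x) (c • y)

/-- The smallest congruence containing `r` that is compatible with addition and multiplication and
(by `presentedCon_smul`) with scalar multiplication. -/
def presentedCon (r : FreeNonUnital k X → FreeNonUnital k X → Prop) : RingCon (FreeNonUnital k X) :=
  ringConGen (ScalarMultiples r)

theorem presentedCon_smul (r : FreeNonUnital k X → FreeNonUnital k X → Prop) (c : k)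
    {x y : FreeNonUnital k X} (h : presentedCon r x y) : presentedCon r (c • x) (c • y) := by
  change RingConGen.Rel (ScalarMultiples r) x y at h
  change RingConGen.Rel (ScalarMultiples r) (c • x) (c • y)
  induction h with
  | of x y h =>
    obtain ⟨d, h⟩ := h
    rw [smul_smul, smul_smul]
    exact RingConGen.Rel.of _ _ (ScalarMultiples.smul _ h)
  | refl x => exact RingConGen.Rel.refl _
  | symm _ ih => exact RingConGen.Rel.symm ih
  | trans _ _ ih₁ ih₂ => exact RingConGen.Rel.trans ih₁ ih₂
  | add _ _ ih₁ ih₂ => rw [smul_add, smul_add]; exact RingConGen.Rel.add ih₁ ih₂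
  | mul _ h₂ ih₁ _ =>
    rw [← smul_mul_assoc, ← smul_mul_assoc]; exact RingConGen.Rel.mul ih₁ h₂

/-- The associative `k`-algebra without unit generated by `X` subject to the relations `x = y`
for all `x, y` with `r x y`. -/
def Presented (r : FreeNonUnital k X → FreeNonUnital k X → Prop) : Type :=
  (presentedCon r).Quotient

namespace Presented

variable (r : FreeNonUnital k X → FreeNonUnital k X → Prop)

instance : NonUnitalRing (Presented r) :=
  inferInstanceAs (NonUnitalRing (presentedCon r).Quotient)

instance : SMul k (Presented r) where
  smul c := Quotient.map (c • ·) fun _ _ h => presentedCon_smul r c h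

/-- The class of an element of the free algebra. -/
def mk (x : FreeNonUnital k X) : Presented r := ((x : (presentedCon r).Quotient))

instance : Module k (Presented r) where
  one_smul x := by
    induction x using Quotient.ind with
    | _ x => exact congrArg (mk r) (one_smul k x)
  mul_smul a b x := by
    induction x using Quotient.ind with
    | _ x => exact congrArg (mk r) (mul_smul a b x)
  smul_zero a := congrArg (mk r) (smul_zero a)
  smul_add a x y := by
    induction x using Quotient.ind with
    | _ x =>
      induction y using Quotient.ind with
      | _ y => exact congrArg (mk r) (smul_add a x y)
  add_smul a b x := by
    induction x using Quotient.ind with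
    | _ x => exact congrArg (mk r) (add_smul a b x)
  zero_smul x := by
    induction x using Quotient.ind with
    | _ x => exact congrArg (mk r) (zero_smul k x)

instance : IsScalarTower k (Presented r) (Presented r) where
  smul_assoc a x y := by
    induction x using Quotient.ind with
    | _ x =>
      induction y using Quotient.ind with
      | _ y => exact congrArg (mk r) (smul_mul_assoc a x y)

instance : SMulCommClass k (Presented r) (Presented r) where
  smul_comm a x y := by
    induction x using Quotient.ind with
    | _ x =>
      induction y using Quotient.ind with
      | _ y => exact congrArg (mk r) (mul_smul_comm a x y).symm

end Presented

end Presentation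

/-! ### Modified algebras of rank one -/

/-- The generators `1_l`, `E_{l,l-2}` and `F_{l,l+2}`, for `l : ℤ`, named by their first index. -/
inductive Gen : Type
  | one (l : ℤ)
  | E (l : ℤ)
  | F (l : ℤ)

section Dot

variable {k : Type} [Field k]

open FreeNonUnital Gen in
/-- The defining relations, for a sign `s` and a family of scalars `c`:
the `1_l` are orthogonal idempotents, `E_{l,l-2} = 1_l E_{l,l-2} 1_{l-2}`,
`F_{l,l+2} = 1_l F_{l,l+2} 1_{l+2}`, and
`E_{l,l-2} F_{l-2,l} - s F_{l,l+2} E_{l+2,l} = c_l 1_l`. -/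
inductive DotRel (s : k) (c : ℤ → k) : FreeNonUnital k Gen → FreeNonUnital k Gen → Prop
  | one_one (l m : ℤ) : DotRel s c (gen (one l) * gen (one m)) (if l = m then gen (one l) else 0)
  | E_one (l m : ℤ) : DotRel s c (gen (E l) * gen (one m)) (if l - 2 = m then gen (E l) else 0)
  | one_E (l m : ℤ) : DotRel s c (gen (one m) * gen (E l)) (if m = l then gen (E l) else 0)
  | F_one (l m : ℤ) : DotRel s c (gen (F l) * gen (one m)) (if l + 2 = m then gen (F l) else 0)
  | one_F (l m : ℤ) : DotRel s c (gen (one m) * gen (F l)) (if m = l then gen (F l) else 0)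
  | comm (l : ℤ) : DotRel s c
      (gen (E l) * gen (F (l - 2)) - s • (gen (F l) * gen (E (l + 2)))) (c l • gen (one l))

/-- The associative `k`-algebra without unit with the generators `Gen` and the relations
`DotRel s c`. -/
abbrev DotAlgebra (s : k) (c : ℤ → k) : Type := Presented (DotRel s c)

namespace DotAlgebra

variable (s : k) (c : ℤ → k)

/-- The idempotent `1_l`. -/
def one (l : ℤ) : DotAlgebra s c := Presented.mk _ (FreeNonUnital.gen (Gen.one l))

/-- The generator `E_{l,l-2}`. -/
def E (l : ℤ) : DotAlgebra s c := Presented.mk _ (FreeNonUnital.gen (Gen.E l))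

/-- The generator `F_{l,l+2}`. -/
def F (l : ℤ) : DotAlgebra s c := Presented.mk _ (FreeNonUnital.gen (Gen.F l))

/-- `E^a 1_l`. -/
def EPowOne (l : ℤ) : ℕ → DotAlgebra s c
  | 0 => one s c l
  | a + 1 => E s c (l + 2 * a + 2) * EPowOne l a

/-- `1_l E^a`. -/
def oneEPow (l : ℤ) : ℕ → DotAlgebra s c
  | 0 => one s c l
  | a + 1 => oneEPow l a * E s c (l - 2 * a)

/-- `F^b 1_l`. -/
def FPowOne (l : ℤ) : ℕ → DotAlgebra s c
  | 0 => one s c l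
  | b + 1 => F s c (l - 2 * b - 2) * FPowOne l b

/-- `1_l F^b`. -/
def oneFPow (l : ℤ) : ℕ → DotAlgebra s c
  | 0 => one s c l
  | b + 1 => oneFPow l b * F s c (l + 2 * b)

end DotAlgebra

/-- The quantum integer `[n]_v = (v^n - v^{-n}) / (v - v^{-1})`. -/
def qInt (v : k) (n : ℤ) : k := (v ^ n - v ^ (-n)) / (v - v⁻¹)

/-- The quantum factorial `[n]_v! = [1]_v [2]_v ⋯ [n]_v`. -/
def qFactorial (v : k) (n : ℕ) : k := ∏ j ∈ Finset.range n, qInt v (j + 1)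

/-- The quantum integer with parameters `(q, π)`:
`((π q)^n - q^{-n}) / (π q - q^{-1})`. -/
def qpiInt (q π : k) (n : ℤ) : k := ((π * q) ^ n - q ^ (-n)) / (π * q - q⁻¹)

end Dot

/-! ### The ground field -/

open Polynomial in
instance irreducible_X_sq_add_one : Fact (Irreducible (X ^ 2 + 1 : ℚ[X])) := by
  refine ⟨?_⟩
  have hd : (X ^ 2 + 1 : ℚ[X]).natDegree = 2 := by
    have h : (X ^ 2 + C 1 : ℚ[X]).natDegree = 2 := natDegree_X_pow_add_C
    simpa using h
  rw [Polynomial.irreducible_iff_roots_eq_zero_of_degree_le_three (by omega) (by omega)]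
  rw [Multiset.eq_zero_iff_forall_notMem]
  intro a ha
  have h := Polynomial.isRoot_of_mem_roots ha
  simp only [IsRoot.def, eval_add, eval_pow, eval_X, eval_one] at h
  nlinarith [sq_nonneg a]

open Polynomial in
/-- The field `ℚ[t]` with `t² = -1`. -/
abbrev Qt : Type := AdjoinRoot (X ^ 2 + 1 : ℚ[X])

/-- The field `ℚ[t](v)` of rational functions in the indeterminate `v`. -/
def Qtv : Type := RatFunc Qt

instance : Field Qtv := inferInstanceAs (Field (RatFunc Qt))

/-- The indeterminate `v`. -/
def v : Qtv := (RatFunc.X : RatFunc Qt)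

/-- The imaginary unit `t`. -/
def t : Qtv := (RatFunc.C (AdjoinRoot.root _) : RatFunc Qt)

/-- `p(l) = 0` for even `l` and `p(l) = 1` for odd `l`. -/
def p (l : ℤ) : ℤ := if Even l then 0 else 1

/-- The semiring `ℕ[v, v⁻¹]` inside `ℚ[t](v)`. -/
def natLaurent : Subsemiring Qtv := Subsemiring.closure {v, v⁻¹}

/-! ### The three modified algebras -/

/-- Scalars of the `sl(2)` commutator relation: `[l]_v`. -/
def cSl (l : ℤ) : Qtv := qInt v l

/-- Scalars of the `osp(1|2)` commutator relation: `t^{-l-p(l)} [l]_v`. -/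
def cOsp (l : ℤ) : Qtv := t ^ (-l - p l) * qInt v l

/-- Lusztig's modified quantum `sl(2)` over `ℚ[t](v)`:
`E_{l,l-2} F_{l-2,l} - F_{l,l+2} E_{l+2,l} = [l]_v 1_l`. -/
abbrev USl : Type := DotAlgebra (1 : Qtv) cSl

/-- The new modified quantum `osp(1|2)`:
`E_{l,l-2} F_{l-2,l} - t² F_{l,l+2} E_{l+2,l} = t^{-l-p(l)} [l]_v 1_l`. -/
abbrev UOsp : Type := DotAlgebra (t ^ 2 : Qtv) cOsp

/-- Clark and Wang's modified quantum `osp(1|2)`, with parameters `q` and `π = -1`: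
`E_{l,l-2} F_{l-2,l} - π F_{l,l+2} E_{l+2,l} = ((π q)^l - q^{-l}) / (π q - q^{-1}) 1_l`,
over `ℚ[t](v)` through `q = v t⁻¹`. -/
abbrev UClarkWang : Type := DotAlgebra (-1 : Qtv) (qpiInt (v * t⁻¹) (-1))

open DotAlgebra in
/-- Lusztig's canonical basis of modified quantum `sl(2)`: the elements `E^{(a)} 1_{-n} F^{(b)}`
and `F^{(b)} 1_n E^{(a)}` for natural numbers `a, b, n` with `a + b ≤ n`, where
`E^{(a)} = E^a / [a]_v!` and `F^{(b)} = F^b / [b]_v!`. As a set, the two families overlap in the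
elements with `n = a + b`. -/
def canonicalBasis : Set USl :=
  {x | ∃ a b n : ℕ, a + b ≤ n ∧
    (x = (qFactorial v a * qFactorial v b)⁻¹ • (EPowOne 1 cSl (-n) a * oneFPow 1 cSl (-n) b) ∨
     x = (qFactorial v a * qFactorial v b)⁻¹ • (FPowOne 1 cSl n b * oneEPow 1 cSl n a))}

/-- The assignment on generators `E_{l,l-2} ↦ t^{l+p(l)} E_{l,l-2}`, `F_{l,l+2} ↦ F_{l,l+2}`,
`1_l ↦ 1_l`. -/
def IsRescaling (φ : USl →ₙₐ[Qtv] UOsp) : Prop :=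
  ∀ l : ℤ,
    φ (DotAlgebra.E 1 cSl l) = t ^ (l + p l) • DotAlgebra.E (t ^ 2) cOsp l ∧
    φ (DotAlgebra.F 1 cSl l) = DotAlgebra.F (t ^ 2) cOsp l ∧
    φ (DotAlgebra.one 1 cSl l) = DotAlgebra.one (t ^ 2) cOsp l

end ModifiedQuantum

end

/-! All three algebras have the same shape, and replacing `E_{l,l-2}` by a nonzero multiple `a l` of
itself changes only `s` and `c`: it carries `(s, c)` to `(s', c')` as soon as `s * a (l + 2) = a l *
s'` and `a l * c' l = c l`. Suitable powers of `t` solve these equations for both required pairs of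
algebras (`rescale`, `rescale_bijective`), which gives (a) and (b).

For (c), the isomorphism transports bases and structure constants, so the work is on the `sl(2)`
side. Index the canonical basis by leading terms: the triple `(b, a, m)` stands for `F^{(b)} E^{(a)}
1_m` if `b ≤ a + m` and for `E^{(a)} F^{(b)} 1_m` if `a + m ≤ b`. On the free module over these
triples, define operators by the formulas that left multiplication by `E` and `F` must satisfy. They
obey the `sl(2)` relations (`raise_lower_sub`), hence give a representation `regularRep`. The
canonical element of index `(b, a, m)` sends the vacuum vector `e 0 0 m` to `e b a m` and kills the
other vacua, so the canonical elements are independent. They span by commuting `E` past `F`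
(`span_canonicalElement`), and coordinates are read off from the action on vacua
(`canonicalElementBasis_repr`).

Structure constants are therefore matrix entries of canonical elements. These act through divided
powers of the two operators, and closed formulas for such powers have products of Gaussian binomials
as coefficients (`raise_divPow_mem`), which lie in `ℕ[q, q⁻¹]`. -/

noncomputable section

namespace ModifiedQuantum

/-! ### Universal property of presented algebras without unit -/

namespace Presented

variable {k : Type} [Field k] {X : Type} {r : FreeNonUnital k X → FreeNonUnital k X → Prop}

/-- The quotient map onto a presented algebra, as a homomorphism of algebras without unit. -/
def mkHom (r : FreeNonUnital k X → FreeNonUnital k X → Prop) :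
    FreeNonUnital k X →ₙₐ[k] Presented r where
  toFun := mk r
  map_smul' _ _ := rfl
  map_zero' := rfl
  map_add' _ _ := rfl
  map_mul' _ _ := rfl

theorem mk_eq_mk_of_rel {x y : FreeNonUnital k X} (h : r x y) : mk r x = mk r y := by
  refine (RingCon.eq (presentedCon r)).2 (RingConGen.Rel.of _ _ ?_)
  simpa only [one_smul] using ScalarMultiples.smul (1 : k) h

/-- Induction on the elements of a presented algebra, by words. -/
theorem induction_word {C : Presented r → Prop}
    (gen : ∀ x, C (mk r (FreeNonUnital.gen x)))
    (gen_mul : ∀ x y, C y → C (mk r (FreeNonUnital.gen x) * y))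
    (zero : C 0) (add : ∀ x y, C x → C y → C (x + y)) (smul : ∀ (a : k) x, C x → C (a • x))
    (x : Presented r) : C x := by
  induction x using Quotient.ind with
  | _ x =>
  change C (mkHom r x)
  induction x using MonoidAlgebra.induction_linear with
  | zero => rw [map_zero]; exact zero
  | add x y hx hy => rw [map_add]; exact add _ _ hx hy
  | single w a =>
    have hw : C (mkHom r (MonoidAlgebra.single w 1)) := by
      induction w using FreeSemigroup.recOnMul with
      | ih1 x => exact gen x
      | ih2 x w _ hw =>
        have h : (MonoidAlgebra.single (FreeSemigroup.of x * w) 1 : FreeNonUnital k X) =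
            FreeNonUnital.gen x * MonoidAlgebra.single w 1 := by
          rw [FreeNonUnital.gen, MonoidAlgebra.single_mul_single, one_mul]
        rw [h, map_mul]
        exact gen_mul _ _ hw
    have h : (MonoidAlgebra.single w a : FreeNonUnital k X) = a • MonoidAlgebra.single w 1 := by
      rw [MonoidAlgebra.smul_single, smul_eq_mul, mul_one]
    rw [h, map_smul]
    exact smul _ _ hw

variable {A : Type*} [NonUnitalRing A] [Module k A]

/-- Homomorphisms from a presented algebra are determined by the images of the generators. -/
theorem hom_ext {f g : Presented r →ₙₐ[k] A}
    (h : ∀ x, f (mk r (FreeNonUnital.gen x)) = g (mk r (FreeNonUnital.gen x))) : f = g := by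
  ext x
  induction x using induction_word with
  | gen x => exact h x
  | gen_mul x y hy => rw [map_mul, map_mul, h, hy]
  | zero => rw [map_zero, map_zero]
  | add x y hx hy => rw [map_add, map_add, hx, hy]
  | smul a x hx => rw [map_smul, map_smul, hx]

variable [IsScalarTower k A A] [SMulCommClass k A A]

/-- The homomorphism from the free algebra without unit given by the images of the generators. -/
def freeLift (k : Type) [Field k] [Module k A] [IsScalarTower k A A] [SMulCommClass k A A]
    (f : X → A) : FreeNonUnital k X →ₙₐ[k] A :=
  MonoidAlgebra.liftMagma k (FreeSemigroup.lift f)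

@[simp]
theorem freeLift_gen (f : X → A) (x : X) : freeLift k f (FreeNonUnital.gen x) = f x := by
  simp [freeLift, FreeNonUnital.gen]

theorem freeLift_eq_of_presentedCon (f : X → A)
    (hf : ∀ x y, r x y → freeLift k f x = freeLift k f y)
    {x y : FreeNonUnital k X} (h : presentedCon r x y) : freeLift k f x = freeLift k f y := by
  change RingConGen.Rel (ScalarMultiples r) x y at h
  induction h with
  | of x y h =>
    obtain ⟨d, h⟩ := h
    rw [map_smul, map_smul, hf _ _ h]
  | refl x => rfl
  | symm _ ih => exact ih.symm
  | trans _ _ ih₁ ih₂ => exact ih₁.trans ih₂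
  | add _ _ ih₁ ih₂ => rw [map_add, map_add, ih₁, ih₂]
  | mul _ _ ih₁ ih₂ => rw [map_mul, map_mul, ih₁, ih₂]

/-- The universal property of a presented algebra. -/
def lift (f : X → A) (hf : ∀ x y, r x y → freeLift k f x = freeLift k f y) :
    Presented r →ₙₐ[k] A where
  toFun := Quotient.lift (freeLift k f) fun _ _ h => freeLift_eq_of_presentedCon f hf h
  map_smul' a x := by
    induction x using Quotient.ind with
    | _ x => exact map_smul (freeLift k f) a x
  map_zero' := map_zero (freeLift k f)
  map_add' x y := by
    induction x using Quotient.ind with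
    | _ x =>
      induction y using Quotient.ind with
      | _ y => exact map_add (freeLift k f) x y
  map_mul' x y := by
    induction x using Quotient.ind with
    | _ x =>
      induction y using Quotient.ind with
      | _ y => exact map_mul (freeLift k f) x y

theorem lift_gen (f : X → A) (hf : ∀ x y, r x y → freeLift k f x = freeLift k f y) (x : X) :
    lift f hf (mk r (FreeNonUnital.gen x)) = f x :=
  freeLift_gen f x

end Presented

/-! ### Relations, universal property and rescaling of the modified algebras -/

namespace DotAlgebra

variable {k : Type} [Field k] {s : k} {c : ℤ → k}

theorem one_mul_one (l m : ℤ) : one s c l * one s c m = if l = m then one s c l else 0 := by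
  have h := Presented.mk_eq_mk_of_rel (DotRel.one_one (s := s) (c := c) l m)
  rw [apply_ite (Presented.mk _)] at h
  exact h

theorem E_mul_one (l m : ℤ) : E s c l * one s c m = if l - 2 = m then E s c l else 0 := by
  have h := Presented.mk_eq_mk_of_rel (DotRel.E_one (s := s) (c := c) l m)
  rw [apply_ite (Presented.mk _)] at h
  exact h

theorem one_mul_E (l m : ℤ) : one s c m * E s c l = if m = l then E s c l else 0 := by
  have h := Presented.mk_eq_mk_of_rel (DotRel.one_E (s := s) (c := c) l m)
  rw [apply_ite (Presented.mk _)] at h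
  exact h

theorem F_mul_one (l m : ℤ) : F s c l * one s c m = if l + 2 = m then F s c l else 0 := by
  have h := Presented.mk_eq_mk_of_rel (DotRel.F_one (s := s) (c := c) l m)
  rw [apply_ite (Presented.mk _)] at h
  exact h

theorem one_mul_F (l m : ℤ) : one s c m * F s c l = if m = l then F s c l else 0 := by
  have h := Presented.mk_eq_mk_of_rel (DotRel.one_F (s := s) (c := c) l m)
  rw [apply_ite (Presented.mk _)] at h
  exact h

theorem E_mul_F (l : ℤ) :
    E s c l * F s c (l - 2) = s • (F s c l * E s c (l + 2)) + c l • one s c l := by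
  have h := Presented.mk_eq_mk_of_rel (DotRel.comm (s := s) (c := c) l)
  exact sub_eq_iff_eq_add'.1 h

variable {A : Type*} [NonUnitalRing A] [Module k A]

theorem hom_ext {f g : DotAlgebra s c →ₙₐ[k] A} (h1 : ∀ l, f (one s c l) = g (one s c l))
    (hE : ∀ l, f (E s c l) = g (E s c l)) (hF : ∀ l, f (F s c l) = g (F s c l)) : f = g := by
  refine Presented.hom_ext fun x => ?_
  cases x with
  | one l => exact h1 l
  | E l => exact hE l
  | F l => exact hF l

variable [IsScalarTower k A A] [SMulCommClass k A A]

/-- The images of the generators under a homomorphism. -/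
def genMap (i e f : ℤ → A) : Gen → A
  | .one l => i l
  | .E l => e l
  | .F l => f l

/-- The universal property of the modified algebras. -/
def lift (s : k) (c : ℤ → k) (i e f : ℤ → A)
    (h11 : ∀ l m, i l * i m = if l = m then i l else 0)
    (hE1 : ∀ l m, e l * i m = if l - 2 = m then e l else 0)
    (h1E : ∀ l m, i m * e l = if m = l then e l else 0)
    (hF1 : ∀ l m, f l * i m = if l + 2 = m then f l else 0)
    (h1F : ∀ l m, i m * f l = if m = l then f l else 0)
    (hc : ∀ l, e l * f (l - 2) - s • (f l * e (l + 2)) = c l • i l) :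
    DotAlgebra s c →ₙₐ[k] A :=
  Presented.lift (genMap i e f) fun x y h => by
    cases h with
    | one_one l m => simp only [map_mul, apply_ite (Presented.freeLift k (genMap i e f)), map_zero,
        Presented.freeLift_gen]; exact h11 l m
    | E_one l m => simp only [map_mul, apply_ite (Presented.freeLift k (genMap i e f)), map_zero,
        Presented.freeLift_gen]; exact hE1 l m
    | one_E l m => simp only [map_mul, apply_ite (Presented.freeLift k (genMap i e f)), map_zero,
        Presented.freeLift_gen]; exact h1E l m
    | F_one l m => simp only [map_mul, apply_ite (Presented.freeLift k (genMap i e f)), map_zero,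
        Presented.freeLift_gen]; exact hF1 l m
    | one_F l m => simp only [map_mul, apply_ite (Presented.freeLift k (genMap i e f)), map_zero,
        Presented.freeLift_gen]; exact h1F l m
    | comm l =>
      simp only [map_mul, map_sub, map_smul, Presented.freeLift_gen]
      exact hc l

section LiftGen

variable {i e f : ℤ → A}
    {h11 : ∀ l m, i l * i m = if l = m then i l else 0}
    {hE1 : ∀ l m, e l * i m = if l - 2 = m then e l else 0}
    {h1E : ∀ l m, i m * e l = if m = l then e l else 0}
    {hF1 : ∀ l m, f l * i m = if l + 2 = m then f l else 0}
    {h1F : ∀ l m, i m * f l = if m = l then f l else 0}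
    {hc : ∀ l, e l * f (l - 2) - s • (f l * e (l + 2)) = c l • i l}

theorem lift_one (l : ℤ) : lift s c i e f h11 hE1 h1E hF1 h1F hc (one s c l) = i l :=
  Presented.lift_gen _ _ _

theorem lift_E (l : ℤ) : lift s c i e f h11 hE1 h1E hF1 h1F hc (E s c l) = e l :=
  Presented.lift_gen _ _ _

theorem lift_F (l : ℤ) : lift s c i e f h11 hE1 h1E hF1 h1F hc (F s c l) = f l :=
  Presented.lift_gen _ _ _

end LiftGen

/-- The homomorphism that multiplies `E_{l,l-2}` by `a l` and fixes the other generators. -/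
def rescale {s s' : k} {c c' : ℤ → k} (a : ℤ → k) (hs : ∀ l, s * a (l + 2) = a l * s')
    (hc : ∀ l, a l * c' l = c l) : DotAlgebra s c →ₙₐ[k] DotAlgebra s' c' :=
  lift s c (one s' c') (fun l => a l • E s' c' l) (F s' c') one_mul_one
    (fun l m => by rw [smul_mul_assoc, E_mul_one, smul_ite, smul_zero])
    (fun l m => by rw [mul_smul_comm, one_mul_E, smul_ite, smul_zero])
    F_mul_one one_mul_F
    (fun l => by
      rw [smul_mul_assoc, mul_smul_comm, E_mul_F, smul_add, smul_smul, smul_smul, smul_smul, hs,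
        hc, add_sub_cancel_left])

section Rescale

variable {s s' : k} {c c' : ℤ → k} {a : ℤ → k} {hs : ∀ l, s * a (l + 2) = a l * s'}
  {hc : ∀ l, a l * c' l = c l}

theorem rescale_one (l : ℤ) : rescale a hs hc (one s c l) = one s' c' l := lift_one l

theorem rescale_E (l : ℤ) : rescale a hs hc (E s c l) = a l • E s' c' l := lift_E l

theorem rescale_F (l : ℤ) : rescale a hs hc (F s c l) = F s' c' l := lift_F l

/-- The two compatibility conditions are symmetric under exchanging the algebras and inverting `a`,
so rescaling by `(a l)⁻¹` is a homomorphism back; the composites fix the generators. -/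
theorem rescale_bijective (ha : ∀ l, a l ≠ 0) : Function.Bijective (rescale a hs hc) := by
  have hs' : ∀ l, s' * (a (l + 2))⁻¹ = (a l)⁻¹ * s := fun l => by
    have := hs l
    have := ha l
    have := ha (l + 2)
    field_simp
    linear_combination -hs l
  have hc' : ∀ l, (a l)⁻¹ * c l = c' l := fun l => by
    rw [← hc, inv_mul_cancel_left₀ (ha l)]
  have h₁ : (rescale (fun l => (a l)⁻¹) hs' hc').comp (rescale a hs hc) =
      NonUnitalAlgHom.id k (DotAlgebra s c) := by
    refine hom_ext (fun l => ?_) (fun l => ?_) fun l => ?_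
    · simp [rescale_one]
    · simp [rescale_E, smul_smul, ha l]
    · simp [rescale_F]
  have h₂ : (rescale a hs hc).comp (rescale (fun l => (a l)⁻¹) hs' hc') =
      NonUnitalAlgHom.id k (DotAlgebra s' c') := by
    refine hom_ext (fun l => ?_) (fun l => ?_) fun l => ?_
    · simp [rescale_one]
    · simp [rescale_E, smul_smul, ha l]
    · simp [rescale_F]
  exact Function.bijective_iff_has_inverse.2
    ⟨_, fun x => DFunLike.congr_fun h₁ x, fun x => DFunLike.congr_fun h₂ x⟩

end Rescale

end DotAlgebra

/-! ### Quantum integers, factorials and Gaussian binomials -/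

section QuantumIntegers

variable {k : Type} [Field k] {q : k}

@[simp]
theorem qInt_zero : qInt q 0 = 0 := by simp [qInt]

@[simp]
theorem qInt_neg (x : ℤ) : qInt q (-x) = -qInt q x := by
  rw [qInt, qInt, neg_neg, ← neg_div, neg_sub]

/-- `q` is nonzero and not a root of unity. -/
structure IsGeneric (q : k) : Prop where
  ne_zero : q ≠ 0
  pow_ne_one : ∀ n : ℕ, q ^ (n + 1) ≠ 1

namespace IsGeneric

theorem zpow_sub_zpow_neg_ne_zero (hq : IsGeneric q) (n : ℕ) :
    q ^ (n + 1 : ℤ) - q ^ (-(n + 1 : ℤ)) ≠ 0 := by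
  intro h
  have h' : q ^ (n + 1 : ℤ) * q ^ (n + 1 : ℤ) = 1 := by
    nth_rewrite 1 [sub_eq_zero.1 h]
    rw [← zpow_add₀ hq.ne_zero, neg_add_cancel, zpow_zero]
  refine hq.pow_ne_one (2 * n + 1) ?_
  rw [← h', ← zpow_add₀ hq.ne_zero, ← zpow_natCast]
  congr 1
  push_cast
  ring

theorem sub_inv_ne_zero (hq : IsGeneric q) : q - q⁻¹ ≠ 0 := by
  simpa using hq.zpow_sub_zpow_neg_ne_zero 0

theorem qInt_one (hq : IsGeneric q) : qInt q 1 = 1 := by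
  rw [qInt, zpow_one, zpow_neg_one, div_self hq.sub_inv_ne_zero]

theorem qInt_succ_ne_zero (hq : IsGeneric q) (n : ℕ) : qInt q (n + 1) ≠ 0 :=
  div_ne_zero (hq.zpow_sub_zpow_neg_ne_zero n) hq.sub_inv_ne_zero

theorem qInt_add (hq : IsGeneric q) (x y : ℤ) :
    qInt q (x + y) = q ^ y * qInt q x + q ^ (-x) * qInt q y := by
  rw [qInt, qInt, qInt, ← mul_div_assoc, ← mul_div_assoc, ← add_div, mul_sub, mul_sub, neg_add,
    zpow_add₀ hq.ne_zero, zpow_add₀ hq.ne_zero]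
  congr 1
  ring

/-- After clearing denominators, the terms in `q ^ (±(x + y - 2 * z))` cancel on the right. This one
identity serves both the commutator relation and the coefficients of powers of `E`. -/
theorem qInt_mul_qInt (hq : IsGeneric q) (x y z : ℤ) :
    qInt q x * qInt q y = qInt q (x - z) * qInt q (y - z) + qInt q z * qInt q (x + y - z) := by
  have h0 := hq.ne_zero
  simp only [qInt]
  rw [div_mul_div_comm, div_mul_div_comm, div_mul_div_comm, ← add_div]
  congr 1
  simp only [neg_sub, zpow_sub₀ h0, zpow_add₀ h0, zpow_neg]
  have hx := zpow_ne_zero x h0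
  have hy := zpow_ne_zero y h0
  have hz := zpow_ne_zero z h0
  field_simp
  ring

theorem qFactorial_ne_zero (hq : IsGeneric q) (n : ℕ) : qFactorial q n ≠ 0 :=
  Finset.prod_ne_zero_iff.2 fun j _ => hq.qInt_succ_ne_zero j

end IsGeneric

@[simp]
theorem qFactorial_zero : qFactorial q 0 = 1 := rfl

theorem qFactorial_succ (n : ℕ) : qFactorial q (n + 1) = qFactorial q n * qInt q (n + 1) :=
  Finset.prod_range_succ _ _

/-- Gaussian binomial coefficients, symmetric under `q ↦ q⁻¹`. -/
def gaussBinom (q : k) : ℕ → ℕ → k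
  | _, 0 => 1
  | 0, _ + 1 => 0
  | n + 1, j + 1 =>
    q ^ (j + 1 : ℤ) * gaussBinom q n (j + 1) + q ^ (j - n : ℤ) * gaussBinom q n j

@[simp]
theorem gaussBinom_zero_right (n : ℕ) : gaussBinom q n 0 = 1 := by cases n <;> rfl

theorem gaussBinom_succ_succ (n j : ℕ) : gaussBinom q (n + 1) (j + 1) =
    q ^ (j + 1 : ℤ) * gaussBinom q n (j + 1) + q ^ (j - n : ℤ) * gaussBinom q n j := rfl

theorem gaussBinom_eq_zero {n j : ℕ} (h : n < j) : gaussBinom q n j = 0 := by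
  induction n generalizing j with
  | zero => obtain ⟨j, rfl⟩ := Nat.exists_eq_succ_of_ne_zero h.ne'; rfl
  | succ n ih =>
    obtain ⟨j, rfl⟩ := Nat.exists_eq_succ_of_ne_zero (Nat.ne_zero_of_lt h)
    rw [Nat.succ_eq_add_one, gaussBinom_succ_succ, ih (by omega), ih (by omega)]
    simp

@[simp]
theorem gaussBinom_self (n : ℕ) : gaussBinom q n n = 1 := by
  induction n with
  | zero => rfl
  | succ n ih => rw [gaussBinom_succ_succ, gaussBinom_eq_zero (Nat.lt_succ_self n), ih]; simp

/-- The Pascal recursion uses only sums and products of powers of `q`. All positivity rests on this,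
and it is invisible in the quotient of factorials. -/
theorem gaussBinom_mem (n j : ℕ) : gaussBinom q n j ∈ Subsemiring.closure {q, q⁻¹} := by
  have hz : ∀ x : ℤ, q ^ x ∈ Subsemiring.closure {q, q⁻¹} := fun x => by
    cases x with
    | ofNat x =>
      rw [Int.ofNat_eq_natCast, zpow_natCast]
      exact pow_mem (Subsemiring.subset_closure (by simp)) _
    | negSucc x =>
      rw [zpow_negSucc, ← inv_pow]
      exact pow_mem (Subsemiring.subset_closure (by simp)) _
  induction n generalizing j with
  | zero =>
    cases j with
    | zero => exact one_mem _
    | succ j => exact zero_mem _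
  | succ n ih =>
    cases j with
    | zero => exact one_mem _
    | succ j => exact add_mem (mul_mem (hz _) (ih _)) (mul_mem (hz _) (ih _))

namespace IsGeneric

/-- The splitting of `[(i + 1) + (j + 1)]` by `qInt_add` has the same powers of `q` as the two terms
of the Pascal recursion. -/
theorem gaussBinom_mul_qFactorial (hq : IsGeneric q) (i j : ℕ) :
    gaussBinom q (i + j) j * (qFactorial q i * qFactorial q j) = qFactorial q (i + j) := by
  induction i generalizing j with
  | zero => simp
  | succ i ihi =>
    induction j with
    | zero => simp
    | succ j ihj =>
      have h₁ := ihi (j + 1)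
      rw [show i + 1 + (j + 1) = (i + 1 + j) + 1 by ring, gaussBinom_succ_succ,
        qFactorial_succ (i + 1 + j), qFactorial_succ i, qFactorial_succ j]
      rw [show i + (j + 1) = i + 1 + j by ring, qFactorial_succ j] at h₁
      rw [qFactorial_succ i] at ihj
      have h₂ := hq.qInt_add (i + 1) (j + 1)
      rw [show ((i + 1 + j : ℕ) : ℤ) + 1 = (i + 1 : ℤ) + (j + 1) by push_cast; ring, h₂,
        show (j : ℤ) - (i + 1 + j : ℕ) = -(i + 1 : ℤ) by push_cast; ring]
      linear_combination q ^ (j + 1 : ℤ) * qInt q (i + 1) * h₁ +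
        q ^ (-(i + 1 : ℤ)) * qInt q (j + 1) * ihj

theorem gaussBinom_eq_div (hq : IsGeneric q) (i j : ℕ) :
    gaussBinom q (i + j) j = qFactorial q (i + j) / (qFactorial q i * qFactorial q j) :=
  eq_div_of_mul_eq (mul_ne_zero (hq.qFactorial_ne_zero i) (hq.qFactorial_ne_zero j))
    (hq.gaussBinom_mul_qFactorial i j)

theorem gaussBinom_succ_right (hq : IsGeneric q) (n j : ℕ) :
    qInt q (j + 1) * gaussBinom q n (j + 1) = qInt q (n - j) * gaussBinom q n j := by
  rcases lt_trichotomy n j with h | rfl | h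
  · rw [gaussBinom_eq_zero h, gaussBinom_eq_zero (by omega), mul_zero, mul_zero]
  · rw [gaussBinom_eq_zero (Nat.lt_succ_self n), sub_self, qInt_zero, mul_zero, zero_mul]
  · obtain ⟨i, rfl⟩ := Nat.exists_eq_add_of_lt h
    have h₁ := hq.gaussBinom_eq_div i (j + 1)
    have h₂ := hq.gaussBinom_eq_div (i + 1) j
    rw [show i + (j + 1) = j + i + 1 by ring] at h₁
    rw [show i + 1 + j = j + i + 1 by ring] at h₂
    rw [h₁, h₂, qFactorial_succ i, qFactorial_succ j,
      show ((j + i + 1 : ℕ) : ℤ) - j = i + 1 by push_cast; ring]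
    have := hq.qFactorial_ne_zero i
    have := hq.qFactorial_ne_zero j
    have := hq.qInt_succ_ne_zero i
    have := hq.qInt_succ_ne_zero j
    field_simp

theorem gaussBinom_succ_left (hq : IsGeneric q) (i j : ℕ) :
    qInt q (i + 1) * gaussBinom q (i + j + 1) j =
      qInt q (i + j + 1) * gaussBinom q (i + j) j := by
  have h₁ := hq.gaussBinom_eq_div (i + 1) j
  rw [show i + 1 + j = i + j + 1 by ring] at h₁
  rw [h₁, hq.gaussBinom_eq_div i j, qFactorial_succ i, qFactorial_succ (i + j)]
  push_cast
  have := hq.qFactorial_ne_zero i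
  have := hq.qFactorial_ne_zero j
  have := hq.qInt_succ_ne_zero i
  field_simp

theorem gaussBinom_succ_succ_mul (hq : IsGeneric q) (n j : ℕ) :
    qInt q (j + 1) * gaussBinom q (n + 1) (j + 1) = qInt q (n + 1) * gaussBinom q n j := by
  rcases lt_or_ge n j with h | h
  · rw [gaussBinom_eq_zero h, gaussBinom_eq_zero (by omega), mul_zero, mul_zero]
  · obtain ⟨i, rfl⟩ := Nat.exists_eq_add_of_le h
    have h₁ := hq.gaussBinom_eq_div i (j + 1)
    have h₂ := hq.gaussBinom_eq_div i j
    rw [show i + (j + 1) = j + i + 1 by ring] at h₁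
    rw [add_comm i j] at h₂
    rw [h₁, h₂, qFactorial_succ j, qFactorial_succ (j + i)]
    have := hq.qFactorial_ne_zero i
    have := hq.qFactorial_ne_zero j
    have := hq.qInt_succ_ne_zero j
    field_simp

end IsGeneric

end QuantumIntegers

/-! ### The regular representation in the canonical basis -/

/-- The vector space with basis the triples `(b, a, m)`, which stand for the canonical basis element
with leading term `F^{(b)} E^{(a)} 1_m`. -/
abbrev CanonicalModule (k : Type) [Field k] : Type := ℕ × ℕ × ℤ →₀ k

namespace CanonicalModule

variable {k : Type} [Field k] {q : k}

/-- The basis vectors. -/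
def e (k : Type) [Field k] (b a : ℕ) (m : ℤ) : CanonicalModule k := Finsupp.single (b, a, m) 1

theorem end_ext {f g : Module.End k (CanonicalModule k)}
    (h : ∀ b a m, f (e k b a m) = g (e k b a m)) : f = g := by
  refine Finsupp.lhom_ext' fun i => LinearMap.ext_ring ?_
  obtain ⟨b, a, m⟩ := i
  exact h b a m

/-- The operator with given values on the basis vectors. -/
def ofBasis (f : ℕ → ℕ → ℤ → CanonicalModule k) : Module.End k (CanonicalModule k) :=
  Finsupp.linearCombination k fun i => f i.1 i.2.1 i.2.2

theorem ofBasis_e (f : ℕ → ℕ → ℤ → CanonicalModule k) (b a : ℕ) (m : ℤ) :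
    ofBasis f (e k b a m) = f b a m := by
  simp [ofBasis, e]

/-- The action of `E` on basis vectors. -/
def raiseStep (q : k) : ℕ → ℕ → ℤ → CanonicalModule k
  | 0, a, m => qInt q (a + 1) • e k 0 (a + 1) m
  -- For `b + 1 ≤ a + m` the vector stands for `F^{(b+1)} E^{(a)} 1_m`, and the second term comes
  -- from commuting `E` past `F^{(b+1)}`. Otherwise it stands for `E^{(a)} F^{(b+1)} 1_m`, and `E`
  -- just lengthens the power.
  | b + 1, a, m => qInt q (a + 1) • e k (b + 1) (a + 1) m +
      if b + 1 ≤ a + m then qInt q (m + 2 * a - b) • e k b a m else 0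

/-- The action of `E`. -/
def raise (q : k) : Module.End k (CanonicalModule k) := ofBasis (raiseStep q)

/-- The involution that exchanges the actions of `E` and `F`. -/
def flip (k : Type) [Field k] : Module.End k (CanonicalModule k) :=
  ofBasis fun b a m => e k a b (-m)

/-- The action of `F`. -/
def lower (q : k) : Module.End k (CanonicalModule k) := flip k * raise q * flip k

/-- The projection onto the weight space of weight `l`. -/
def proj (k : Type) [Field k] (l : ℤ) : Module.End k (CanonicalModule k) :=
  ofBasis fun b a m => if l = m + 2 * a - 2 * b then e k b a m else 0

theorem raise_zero (a : ℕ) (m : ℤ) :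
    raise q (e k 0 a m) = qInt q (a + 1) • e k 0 (a + 1) m := ofBasis_e _ _ _ _

theorem raise_succ (b a : ℕ) (m : ℤ) :
    raise q (e k (b + 1) a m) = qInt q (a + 1) • e k (b + 1) (a + 1) m +
      if b + 1 ≤ a + m then qInt q (m + 2 * a - b) • e k b a m else 0 := ofBasis_e _ _ _ _

theorem raise_of_lt {b a : ℕ} {m : ℤ} (h : a + m < b) :
    raise q (e k b a m) = qInt q (a + 1) • e k b (a + 1) m := by
  cases b with
  | zero => rw [raise_zero]
  | succ b => rw [raise_succ, if_neg (by push_cast at h; omega), add_zero]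

theorem flip_e (b a : ℕ) (m : ℤ) : flip k (e k b a m) = e k a b (-m) := ofBasis_e _ _ _ _

theorem flip_mul_flip : flip k * flip k = 1 :=
  end_ext fun b a m => by
    rw [Module.End.mul_apply, flip_e, flip_e, neg_neg, Module.End.one_apply]

theorem flip_flip (w : CanonicalModule k) : flip k (flip k w) = w :=
  DFunLike.congr_fun flip_mul_flip w

theorem lower_apply (w : CanonicalModule k) : lower q w = flip k (raise q (flip k w)) := rfl

theorem lower_of_lt {b a : ℕ} {m : ℤ} (h : b < a + m) :
    lower q (e k b a m) = qInt q (b + 1) • e k (b + 1) a m := by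
  rw [lower_apply, flip_e, raise_of_lt (by omega), map_smul, flip_e, neg_neg]

theorem proj_e (l : ℤ) (b a : ℕ) (m : ℤ) :
    proj k l (e k b a m) = if l = m + 2 * a - 2 * b then e k b a m else 0 := ofBasis_e _ _ _ _

theorem proj_mul_proj (l m : ℤ) : proj k l * proj k m = if l = m then proj k l else 0 :=
  end_ext fun b a n => by
    rw [Module.End.mul_apply, proj_e, apply_ite (proj k l), proj_e, map_zero]
    split_ifs with h₁ h₂ h₃ h₄ h₅ <;> first | rfl | omega | skip
    · rw [proj_e, if_pos h₂]
    · rw [proj_e, if_neg (by omega)]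

theorem proj_mul_raise (l : ℤ) : proj k l * raise q = raise q * proj k (l - 2) :=
  end_ext fun b a m => by
    rw [Module.End.mul_apply, Module.End.mul_apply, proj_e, apply_ite (raise q), map_zero]
    cases b with
    | zero =>
      rw [raise_zero, map_smul, proj_e]
      simp only [show l = m + 2 * (a + 1 : ℕ) - 2 * (0 : ℕ) ↔
        l - 2 = m + 2 * a - 2 * (0 : ℕ) by omega]
      split_ifs <;> simp
    | succ b =>
      rw [raise_succ, map_add, map_smul, proj_e, apply_ite (proj k l), map_smul, proj_e, map_zero]
      push_cast
      simp only [show l = m + 2 * (a + 1) - 2 * (b + 1) ↔ l = m + 2 * a - 2 * b by omega,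
        show l - 2 = m + 2 * a - 2 * (b + 1) ↔ l = m + 2 * a - 2 * b by omega]
      split_ifs <;> simp

theorem proj_mul_flip (l : ℤ) : proj k l * flip k = flip k * proj k (-l) :=
  end_ext fun b a m => by
    rw [Module.End.mul_apply, Module.End.mul_apply, proj_e, apply_ite (flip k), map_zero, flip_e,
      proj_e]
    simp only [show l = -m + 2 * b - 2 * a ↔ -l = m + 2 * a - 2 * b by omega]

theorem proj_mul_lower (l : ℤ) : proj k l * lower q = lower q * proj k (l + 2) := by
  rw [lower, ← mul_assoc, ← mul_assoc, proj_mul_flip, mul_assoc (flip k), proj_mul_raise,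
    mul_assoc, mul_assoc (raise q), proj_mul_flip, show -(-l - 2) = l + 2 by ring]
  simp only [mul_assoc]

/-- Raising moves strictly inside the region `b < a + m`, where `lower` has a single term. For `b =
0` the second coefficient vanishes since `[0] = 0`. -/
theorem lower_raise_of_le {b a : ℕ} {m : ℤ} (h : b ≤ a + m) :
    lower q (raise q (e k b a m)) = (qInt q (a + 1) * qInt q (b + 1)) • e k (b + 1) (a + 1) m +
      (qInt q (m + 2 * a - b + 1) * qInt q b) • e k b a m := by
  cases b with
  | zero =>
    rw [raise_zero, map_smul, lower_of_lt (by push_cast at h ⊢; omega), smul_smul]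
    simp
  | succ b =>
    rw [raise_succ, if_pos (by push_cast at h; omega), map_add, map_smul, map_smul,
      lower_of_lt (by push_cast at h ⊢; omega), lower_of_lt (by push_cast at h ⊢; omega),
      smul_smul, smul_smul]
    push_cast
    rw [show m + 2 * a - (b + 1) + 1 = m + 2 * a - (b : ℤ) by ring]

theorem raise_lower_of_le {b a : ℕ} {m : ℤ} (h : a + m ≤ b) :
    raise q (lower q (e k b a m)) = (qInt q (b + 1) * qInt q (a + 1)) • e k (b + 1) (a + 1) m +
      (qInt q (-m + 2 * b - a + 1) * qInt q a) • e k b a m := by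
  have := congrArg (flip k) (lower_raise_of_le (q := q) (b := a) (a := b) (m := -m) (by omega))
  simpa only [lower_apply, map_add, map_smul, flip_e, flip_flip, neg_neg] using this

/-- Inside the region `b < a + m`, lowering has one term and stays in `b ≤ a + m`. On the wall `b =
a + m` lowering has two terms and the flipped formula is needed. The multiples of `e (b + 1) (a + 1)
m` cancel in both cases. -/
theorem raise_lower_sub_of_le (hq : IsGeneric q) {b a : ℕ} {m : ℤ} (h : b ≤ a + m) :
    raise q (lower q (e k b a m)) - lower q (raise q (e k b a m)) =
      qInt q (m + 2 * a - 2 * b) • e k b a m := by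
  rw [lower_raise_of_le h]
  rcases h.lt_or_eq with h | h
  · have key := hq.qInt_mul_qInt (b + 1) (m + 2 * a - b) b
    rw [show (b : ℤ) + 1 - b = 1 by ring, hq.qInt_one, one_mul,
      show m + 2 * a - b - b = m + 2 * a - 2 * (b : ℤ) by ring,
      show (b : ℤ) + 1 + (m + 2 * a - b) - b = m + 2 * a - b + 1 by ring] at key
    rw [lower_of_lt h, map_smul, raise_succ, if_pos (by omega), eq_sub_of_add_eq key.symm]
    module
  · have key := hq.qInt_mul_qInt (b + 1) a b
    rw [show (b : ℤ) + 1 - b = 1 by ring, hq.qInt_one, one_mul,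
      show (b : ℤ) + 1 + a - b = a + 1 by ring] at key
    rw [raise_lower_of_le h.ge, show m + 2 * a - 2 * b = (a - b : ℤ) by omega,
      show m + 2 * a - b + 1 = (a + 1 : ℤ) by omega,
      show -m + 2 * b - a + 1 = (b + 1 : ℤ) by omega, eq_sub_of_add_eq key.symm]
    module

theorem raise_lower_sub (hq : IsGeneric q) (b a : ℕ) (m : ℤ) :
    raise q (lower q (e k b a m)) - lower q (raise q (e k b a m)) =
      qInt q (m + 2 * a - 2 * b) • e k b a m := by
  rcases le_or_gt (b : ℤ) (a + m) with h | h
  · exact raise_lower_sub_of_le hq h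
  -- `flip` carries `b > a + m` into the region already treated; exchanging the operators changes
  -- the sign, which `[-l] = -[l]` absorbs.
  · have := congrArg (flip k) (raise_lower_sub_of_le hq (b := a) (a := b) (m := -m) (by omega))
    simp only [lower_apply, map_sub, map_smul, flip_e, flip_flip, neg_neg] at this ⊢
    rw [← neg_sub, this, ← neg_smul, ← qInt_neg]
    congr 2
    ring

theorem raise_mul_lower_sub (hq : IsGeneric q) (l : ℤ) :
    proj k l * (raise q * lower q - lower q * raise q) = qInt q l • proj k l :=
  end_ext fun b a m => by
    rw [Module.End.mul_apply, LinearMap.sub_apply, Module.End.mul_apply, Module.End.mul_apply,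
      raise_lower_sub hq, map_smul, LinearMap.smul_apply, proj_e]
    split_ifs with h
    · rw [h]
    · rw [smul_zero, smul_zero]

end CanonicalModule

open CanonicalModule

/-- The action of modified quantum `sl(2)` on the module spanned by its canonical basis. -/
def regularRep {k : Type} [Field k] {q : k} (hq : IsGeneric q) :
    DotAlgebra (1 : k) (qInt q) →ₙₐ[k] Module.End k (CanonicalModule k) :=
  DotAlgebra.lift 1 (qInt q) (proj k) (fun l => proj k l * raise q) (fun l => proj k l * lower q)
    proj_mul_proj
    (fun l m => by rw [proj_mul_raise, mul_assoc, proj_mul_proj]; split_ifs <;> simp)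
    (fun l m => by
      rw [← mul_assoc, proj_mul_proj]; split_ifs with h <;> simp [h])
    (fun l m => by rw [proj_mul_lower, mul_assoc, proj_mul_proj]; split_ifs <;> simp)
    (fun l m => by
      rw [← mul_assoc, proj_mul_proj]; split_ifs with h <;> simp [h])
    (fun l => by
      have h : proj k l * proj k l = proj k l := by rw [proj_mul_proj, if_pos rfl]
      have hE : proj k l * raise q * (proj k (l - 2) * lower q) =
          proj k l * (raise q * lower q) := by
        rw [← mul_assoc, mul_assoc (proj k l), ← proj_mul_raise, ← mul_assoc, h, mul_assoc]
      have hF : proj k l * lower q * (proj k (l + 2) * raise q) =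
          proj k l * (lower q * raise q) := by
        rw [← mul_assoc, mul_assoc (proj k l), ← proj_mul_lower, ← mul_assoc, h, mul_assoc]
      rw [one_smul, ← raise_mul_lower_sub hq l, hE, hF]
      exact (mul_sub (proj k l) _ _).symm)

/-! ### Ordered monomials and spanning by canonical elements -/

namespace DotAlgebra

variable {k : Type} [Field k] {s : k} {c : ℤ → k}

theorem one_mul_EPowOne (l : ℤ) (a : ℕ) :
    one s c (l + 2 * a) * EPowOne s c l a = EPowOne s c l a := by
  cases a with
  | zero => rw [EPowOne, one_mul_one, if_pos (by simp)]; simp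
  | succ a => rw [EPowOne, ← mul_assoc, one_mul_E, if_pos (by push_cast; ring)]

theorem one_mul_FPowOne (l : ℤ) (b : ℕ) :
    one s c (l - 2 * b) * FPowOne s c l b = FPowOne s c l b := by
  cases b with
  | zero => rw [FPowOne, one_mul_one, if_pos (by simp)]; simp
  | succ b => rw [FPowOne, ← mul_assoc, one_mul_F, if_pos (by push_cast; ring)]

theorem FPowOne_mul_one (l : ℤ) (b : ℕ) : FPowOne s c l b * one s c l = FPowOne s c l b := by
  induction b with
  | zero => rw [FPowOne, one_mul_one, if_pos rfl]
  | succ b ih => rw [FPowOne, mul_assoc, ih]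

theorem one_mul_of_ne {x : DotAlgebra s c} {l m : ℤ} (hx : one s c m * x = x) (h : l ≠ m) :
    one s c l * x = 0 := by
  rw [← hx, ← mul_assoc, one_mul_one, if_neg h, zero_mul]

theorem E_mul_of_ne {x : DotAlgebra s c} {l m : ℤ} (hx : one s c m * x = x) (h : l - 2 ≠ m) :
    E s c l * x = 0 := by
  rw [← hx, ← mul_assoc, E_mul_one, if_neg h, zero_mul]

theorem F_mul_of_ne {x : DotAlgebra s c} {l m : ℤ} (hx : one s c m * x = x) (h : l + 2 ≠ m) :
    F s c l * x = 0 := by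
  rw [← hx, ← mul_assoc, F_mul_one, if_neg h, zero_mul]

theorem EPowOne_succ' (l : ℤ) (a : ℕ) :
    EPowOne s c l (a + 1) = EPowOne s c (l + 2) a * E s c (l + 2) := by
  induction a with
  | zero =>
    rw [EPowOne, EPowOne, EPowOne, E_mul_one, one_mul_E, if_pos (by push_cast; ring), if_pos rfl]
    simp
  | succ a ih =>
    rw [EPowOne, ih, EPowOne, ← mul_assoc]
    congr 3
    push_cast
    ring

theorem FPowOne_succ' (l : ℤ) (b : ℕ) :
    FPowOne s c l (b + 1) = FPowOne s c (l - 2) b * F s c (l - 2) := by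
  induction b with
  | zero =>
    rw [FPowOne, FPowOne, FPowOne, F_mul_one, one_mul_F, if_pos (by push_cast; ring), if_pos rfl]
    simp
  | succ b ih =>
    rw [FPowOne, ih, FPowOne, ← mul_assoc]
    congr 3
    push_cast
    ring

theorem oneEPow_eq (l : ℤ) (a : ℕ) : oneEPow s c l a = EPowOne s c (l - 2 * a) a := by
  induction a with
  | zero => simp [oneEPow, EPowOne]
  | succ a ih =>
    rw [oneEPow, ih, EPowOne_succ']
    push_cast
    rw [show l - 2 * (a + 1) + 2 = l - 2 * (a : ℤ) by ring]

theorem oneFPow_eq (l : ℤ) (b : ℕ) : oneFPow s c l b = FPowOne s c (l + 2 * b) b := by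
  induction b with
  | zero => simp [oneFPow, FPowOne]
  | succ b ih =>
    rw [oneFPow, ih, FPowOne_succ']
    push_cast
    rw [show l + 2 * (b + 1) - 2 = l + 2 * (b : ℤ) by ring]

/-- The monomial `F^b E^a 1_m`. -/
def FE (s : k) (c : ℤ → k) (b a : ℕ) (m : ℤ) : DotAlgebra s c :=
  FPowOne s c (m + 2 * a) b * EPowOne s c m a

/-- The monomial `E^a F^b 1_m`. -/
def EF (s : k) (c : ℤ → k) (b a : ℕ) (m : ℤ) : DotAlgebra s c :=
  EPowOne s c (m - 2 * b) a * FPowOne s c m b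

theorem one_mul_FE (b a : ℕ) (m : ℤ) :
    one s c (m + 2 * a - 2 * b) * FE s c b a m = FE s c b a m := by
  rw [FE, ← mul_assoc, one_mul_FPowOne]

theorem FE_zero_left (a : ℕ) (m : ℤ) : FE s c 0 a m = EPowOne s c m a :=
  one_mul_EPowOne m a

theorem EF_zero_right (b : ℕ) (m : ℤ) : EF s c b 0 m = FE s c b 0 m := by
  rw [EF, FE, EPowOne, one_mul_FPowOne, EPowOne]
  simp [FPowOne_mul_one]

theorem FE_zero_zero (m : ℤ) : FE s c 0 0 m = one s c m := FE_zero_left 0 m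

/-- The scalar `d` is a sum of values of `c`; spanning needs only its existence, so `c` stays
arbitrary. -/
theorem E_mul_FPowOne_succ (c : ℤ → k) (m : ℤ) (b : ℕ) :
    ∃ d : k, E 1 c (m - 2 * b) * FPowOne 1 c m (b + 1) =
      FPowOne 1 c (m + 2) (b + 1) * E 1 c (m + 2) + d • FPowOne 1 c m b := by
  have key : ∀ b : ℕ, E 1 c (m - 2 * b) * FPowOne 1 c m (b + 1) =
      F 1 c (m - 2 * b) * (E 1 c (m - 2 * b + 2) * FPowOne 1 c m b) +
        c (m - 2 * b) • FPowOne 1 c m b := fun b => by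
    rw [FPowOne, ← mul_assoc, E_mul_F, one_smul, add_mul, smul_mul_assoc, one_mul_FPowOne,
      mul_assoc]
  have hF : ∀ b : ℕ, F 1 c (m - 2 * b) * FPowOne 1 c (m + 2) b = FPowOne 1 c (m + 2) (b + 1) :=
    fun b => by rw [FPowOne, show m + 2 - 2 * b - 2 = m - 2 * (b : ℤ) by ring]
  induction b with
  | zero =>
    refine ⟨c m, ?_⟩
    rw [key, ← hF, mul_assoc, FPowOne, FPowOne, one_mul_E, E_mul_one, if_pos (by push_cast; ring),
      if_pos rfl]
    simp
  | succ b ih =>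
    obtain ⟨d, hd⟩ := ih
    refine ⟨d + c (m - 2 * (b + 1 : ℕ)), ?_⟩
    have h : F 1 c (m - 2 * (b + 1 : ℕ)) * FPowOne 1 c m b = FPowOne 1 c m (b + 1) := by
      rw [FPowOne, show m - 2 * (b + 1 : ℕ) = m - 2 * (b : ℤ) - 2 by push_cast; ring]
    rw [key, show m - 2 * (b + 1 : ℕ) + 2 = m - 2 * (b : ℤ) by push_cast; ring, hd, mul_add,
      ← mul_assoc, hF, mul_smul_comm, h, add_smul, add_assoc]

theorem E_mul_FE_zero (a : ℕ) (m : ℤ) :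
    E s c (m + 2 * a + 2) * FE s c 0 a m = FE s c 0 (a + 1) m := by
  rw [FE_zero_left, FE_zero_left, EPowOne]

theorem E_mul_FE_succ (c : ℤ → k) (b a : ℕ) (m : ℤ) :
    ∃ d : k, E 1 c (m + 2 * a - 2 * b) * FE 1 c (b + 1) a m =
      FE 1 c (b + 1) (a + 1) m + d • FE 1 c b a m := by
  obtain ⟨d, hd⟩ := E_mul_FPowOne_succ c (m + 2 * a) b
  refine ⟨d, ?_⟩
  rw [FE, ← mul_assoc, hd, add_mul, smul_mul_assoc, mul_assoc, FE, EPowOne, FE]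
  push_cast
  rw [show m + 2 * a + 2 = m + 2 * (a + 1 : ℤ) by ring]

theorem F_mul_FE (b a : ℕ) (m : ℤ) :
    F s c (m + 2 * a - 2 * b - 2) * FE s c b a m = FE s c (b + 1) a m := by
  rw [FE, ← mul_assoc, FE, FPowOne]

theorem E_mul_EF (b a : ℕ) (m : ℤ) :
    E s c (m + 2 * a - 2 * b + 2) * EF s c b a m = EF s c b (a + 1) m := by
  rw [EF, ← mul_assoc, EF, EPowOne,
    show m + 2 * a - 2 * b + 2 = m - 2 * b + 2 * (a : ℤ) + 2 by ring]

/-- The span is stable under left multiplication by generators and contains every `1_l`. As each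
generator absorbs an idempotent on its right, all words lie in it. -/
theorem span_FE (c : ℤ → k) :
    Submodule.span k {x | ∃ b a m, x = FE 1 c b a m} = ⊤ := by
  set T := Submodule.span k {x | ∃ b a m, x = FE 1 c b a m} with hT
  have mem : ∀ b a m, FE 1 c b a m ∈ T := fun b a m => Submodule.subset_span ⟨b, a, m, rfl⟩
  have gen_mul : ∀ x, ∀ y ∈ T,
      Presented.mk (DotRel 1 c) (FreeNonUnital.gen x) * y ∈ T := fun x y hy => by
    induction hy using Submodule.span_induction with
    | mem y hy =>
      obtain ⟨b, a, m, rfl⟩ := hy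
      have hw := one_mul_FE (s := 1) (c := c) b a m
      cases x with
      | one l =>
        change one 1 c l * _ ∈ T
        by_cases h : l = m + 2 * a - 2 * b
        · rw [h, hw]; exact mem _ _ _
        · rw [one_mul_of_ne hw h]; exact zero_mem _
      | E l =>
        change E 1 c l * _ ∈ T
        by_cases h : l - 2 = m + 2 * a - 2 * b
        · cases b with
          | zero =>
            rw [show l = m + 2 * a + 2 by push_cast at h; omega, E_mul_FE_zero]
            exact mem _ _ _
          | succ b =>
            obtain ⟨d, hd⟩ := E_mul_FE_succ c b a m
            rw [show l = m + 2 * a - 2 * b by push_cast at h; omega, hd]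
            exact add_mem (mem _ _ _) (Submodule.smul_mem _ _ (mem _ _ _))
        · rw [E_mul_of_ne hw h]; exact zero_mem _
      | F l =>
        change F 1 c l * _ ∈ T
        by_cases h : l + 2 = m + 2 * a - 2 * b
        · rw [show l = m + 2 * a - 2 * b - 2 by omega, F_mul_FE]
          exact mem _ _ _
        · rw [F_mul_of_ne hw h]; exact zero_mem _
    | zero => rw [mul_zero]; exact zero_mem _
    | add y z _ _ hy hz => rw [mul_add]; exact add_mem hy hz
    | smul d y _ hy => rw [mul_smul_comm]; exact Submodule.smul_mem _ _ hy
  refine Submodule.eq_top_iff'.2 fun x => ?_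
  induction x using Presented.induction_word with
  | gen x =>
    cases x with
    | one l =>
      have := gen_mul (.one l) _ (mem 0 0 l)
      rw [FE_zero_zero] at this
      change one 1 c l * _ ∈ T at this
      rwa [one_mul_one, if_pos rfl] at this
    | E l =>
      have := gen_mul (.E l) _ (mem 0 0 (l - 2))
      rw [FE_zero_zero] at this
      change E 1 c l * _ ∈ T at this
      rwa [E_mul_one, if_pos rfl] at this
    | F l =>
      have := gen_mul (.F l) _ (mem 0 0 (l + 2))
      rw [FE_zero_zero] at this
      change F 1 c l * _ ∈ T at this
      rwa [F_mul_one, if_pos rfl] at this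
  | gen_mul x y hy => exact gen_mul x y hy
  | zero => exact zero_mem _
  | add x y hx hy => exact add_mem hx hy
  | smul d x hx => exact Submodule.smul_mem _ _ hx

/-- The span of the monomials `F^{b'} E^{a'} 1_m` below `F^b E^a 1_m`. -/
def lowerSpan (c : ℤ → k) (b a : ℕ) (m : ℤ) : Submodule k (DotAlgebra 1 c) :=
  Submodule.span k {x | ∃ b' a', b' < b ∧ a' + b = a + b' ∧ x = FE 1 c b' a' m}

theorem FE_mem_lowerSpan {c : ℤ → k} {b a b' a' : ℕ} (m : ℤ) (h : b' < b) (h' : a' + b = a + b') :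
    FE 1 c b' a' m ∈ lowerSpan c b a m :=
  Submodule.subset_span ⟨b', a', h, h', rfl⟩

theorem E_mul_FE_sub_mem (c : ℤ → k) (b a : ℕ) (m : ℤ) :
    E 1 c (m + 2 * a - 2 * b + 2) * FE 1 c b a m - FE 1 c b (a + 1) m ∈
      lowerSpan c b (a + 1) m := by
  cases b with
  | zero =>
    have h := E_mul_FE_zero (s := 1) (c := c) a m
    rw [Nat.cast_zero, mul_zero, sub_zero, h, sub_self]
    exact zero_mem _
  | succ b =>
    obtain ⟨d, hd⟩ := E_mul_FE_succ c b a m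
    rw [show m + 2 * a - 2 * (b + 1 : ℕ) + 2 = m + 2 * a - 2 * (b : ℤ) by push_cast; ring, hd,
      add_sub_cancel_left]
    exact Submodule.smul_mem _ _ (FE_mem_lowerSpan m (by omega) (by omega))

/-- Each commutation of `E` past `F` removes one factor of both kinds, so the error terms have
smaller `b` and the same `a - b`. -/
theorem EF_sub_FE_mem (c : ℤ → k) (b a : ℕ) (m : ℤ) :
    EF 1 c b a m - FE 1 c b a m ∈ lowerSpan c b a m := by
  induction a with
  | zero => rw [EF_zero_right, sub_self]; exact zero_mem _
  | succ a ih =>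
    have h : ∀ y ∈ lowerSpan c b a m,
        E 1 c (m + 2 * a - 2 * b + 2) * y ∈ lowerSpan c b (a + 1) m := fun y hy => by
      induction hy using Submodule.span_induction with
      | mem y hy =>
        obtain ⟨b', a', hb, ha, rfl⟩ := hy
        have h₁ := E_mul_FE_sub_mem c b' a' m
        rw [show m + 2 * a' - 2 * b' + 2 = m + 2 * a - 2 * (b : ℤ) + 2 by omega] at h₁
        have h₂ : lowerSpan c b' (a' + 1) m ≤ lowerSpan c b (a + 1) m := by
          refine Submodule.span_mono ?_
          rintro _ ⟨b'', a'', hb', ha', rfl⟩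
          exact ⟨b'', a'', by omega, by omega, rfl⟩
        have h₃ := FE_mem_lowerSpan (c := c) m hb (show a' + 1 + b = a + 1 + b' by omega)
        have := add_mem (h₂ h₁) h₃
        rwa [sub_add_cancel] at this
      | zero => rw [mul_zero]; exact zero_mem _
      | add y z _ _ hy hz => rw [mul_add]; exact add_mem hy hz
      | smul d y _ hy => rw [mul_smul_comm]; exact Submodule.smul_mem _ _ hy
    have := add_mem (h _ ih) (E_mul_FE_sub_mem c b a m)
    rwa [mul_sub, E_mul_EF, sub_add_sub_cancel] at this

/-- Inverts the unitriangular change from `FE` to `EF`, by strong induction on `b`. The difference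
`a - b` is tracked because it decides which kind of monomial is canonical. -/
theorem FE_mem_span_EF (c : ℤ → k) (b a : ℕ) (m : ℤ) :
    FE 1 c b a m ∈ Submodule.span k {x | ∃ b' a', a' + b = a + b' ∧ x = EF 1 c b' a' m} := by
  induction b using Nat.strong_induction_on generalizing a with
  | _ b ih =>
    rw [← sub_sub_cancel (EF 1 c b a m) (FE 1 c b a m)]
    refine sub_mem (Submodule.subset_span ⟨b, a, rfl, rfl⟩) ?_
    refine (Submodule.span_le.2 ?_ : lowerSpan c b a m ≤ _) (EF_sub_FE_mem c b a m)
    rintro _ ⟨b', a', hb, ha, rfl⟩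
    refine Submodule.span_mono ?_ (ih b' hb a')
    rintro _ ⟨b'', a'', h, rfl⟩
    exact ⟨b'', a'', by omega, rfl⟩

/-- The canonical basis element with leading term `F^{(b)} E^{(a)} 1_m`. -/
def canonicalElement (q : k) (i : ℕ × ℕ × ℤ) : DotAlgebra (1 : k) (qInt q) :=
  (qFactorial q i.2.1 * qFactorial q i.1)⁻¹ •
    if (i.1 : ℤ) ≤ i.2.1 + i.2.2 then FE 1 (qInt q) i.1 i.2.1 i.2.2
    else EF 1 (qInt q) i.1 i.2.1 i.2.2

/-- The condition `b ≤ a + m` depends only on `m` and `a - b`. So when it fails for `F^b E^a 1_m`,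
it fails for every `EF` monomial in the expansion, and all of these are multiples of canonical
elements. -/
theorem span_canonicalElement {q : k} (hq : IsGeneric q) :
    Submodule.span k (Set.range (canonicalElement q)) = ⊤ := by
  have hne : ∀ b a, qFactorial q a * qFactorial q b ≠ 0 := fun b a =>
    mul_ne_zero (hq.qFactorial_ne_zero _) (hq.qFactorial_ne_zero _)
  have mem : ∀ (b a : ℕ) (m : ℤ),
      (if (b : ℤ) ≤ a + m then FE 1 (qInt q) b a m else EF 1 (qInt q) b a m) ∈
      Submodule.span k (Set.range (canonicalElement q)) := fun b a m => by
    rw [← smul_inv_smul₀ (hne b a) (ite _ _ _)]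
    exact Submodule.smul_mem _ _ (Submodule.subset_span ⟨(b, a, m), rfl⟩)
  rw [← top_le_iff, ← span_FE, Submodule.span_le]
  rintro _ ⟨b, a, m, rfl⟩
  by_cases h : (b : ℤ) ≤ a + m
  · simpa only [if_pos h, SetLike.mem_coe] using mem b a m
  · refine Submodule.span_le.2 ?_ (FE_mem_span_EF _ b a m)
    rintro _ ⟨b', a', h', rfl⟩
    simpa only [if_neg (show ¬ (b' : ℤ) ≤ a' + m by omega), SetLike.mem_coe] using mem b' a' m

end DotAlgebra

namespace CanonicalModule

variable {k : Type} [Field k] {q : k}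

/-! ### Powers of the operators -/

theorem proj_mul_raise_pow (l : ℤ) (a : ℕ) :
    proj k (l + 2 * a) * raise q ^ a = raise q ^ a * proj k l := by
  induction a with
  | zero => simp
  | succ a ih =>
    rw [pow_succ', ← mul_assoc, proj_mul_raise, mul_assoc,
      show l + 2 * (a + 1 : ℕ) - 2 = l + 2 * (a : ℤ) by push_cast; ring, ih, mul_assoc]

theorem proj_mul_lower_pow (l : ℤ) (b : ℕ) :
    proj k (l - 2 * b) * lower q ^ b = lower q ^ b * proj k l := by
  induction b with
  | zero => simp
  | succ b ih =>
    rw [pow_succ', ← mul_assoc, proj_mul_lower, mul_assoc,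
      show l - 2 * (b + 1 : ℕ) + 2 = l - 2 * (b : ℤ) by push_cast; ring, ih, mul_assoc]

theorem lower_pow (n : ℕ) : lower q ^ n = flip k * raise q ^ n * flip k := by
  induction n with
  | zero => simp [flip_mul_flip]
  | succ n ih =>
    rw [pow_succ, ih, lower, pow_succ]
    simp only [mul_assoc]
    rw [← mul_assoc (flip k) (flip k), flip_mul_flip, one_mul]

/-- Every vector before the last step lies strictly in `a + m < b`, where raising has one term.
Keeping factorials on both sides avoids division, hence any genericity assumption. -/
theorem raise_pow_of_le {b a n : ℕ} {m : ℤ} (h : a + n + m ≤ b) :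
    qFactorial q a • (raise q ^ n) (e k b a m) = qFactorial q (a + n) • e k b (a + n) m := by
  induction n with
  | zero => simp
  | succ n ih =>
    push_cast at h
    rw [pow_succ', Module.End.mul_apply, ← map_smul, ih (by omega), map_smul,
      raise_of_lt (by push_cast; omega), smul_smul, ← Nat.add_assoc, qFactorial_succ]

theorem lower_pow_of_le {b a n : ℕ} {m : ℤ} (h : b + n ≤ a + m) :
    qFactorial q b • (lower q ^ n) (e k b a m) = qFactorial q (b + n) • e k (b + n) a m := by
  rw [lower_pow, Module.End.mul_apply, Module.End.mul_apply, flip_e, ← map_smul,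
    raise_pow_of_le (by omega), map_smul, flip_e, neg_neg]

theorem raise_pow_vacuum (a : ℕ) (m : ℤ) :
    (raise q ^ a) (e k 0 0 m) = qFactorial q a • e k 0 a m := by
  induction a with
  | zero => simp
  | succ a ih =>
    rw [pow_succ', Module.End.mul_apply, ih, map_smul, raise_zero, smul_smul, qFactorial_succ]

theorem lower_pow_vacuum (b : ℕ) (m : ℤ) :
    (lower q ^ b) (e k 0 0 m) = qFactorial q b • e k b 0 m := by
  rw [lower_pow, Module.End.mul_apply, Module.End.mul_apply, flip_e, raise_pow_vacuum, map_smul,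
    flip_e, neg_neg]

end CanonicalModule

open CanonicalModule DotAlgebra

/-! ### Action on vacuum vectors and the canonical basis -/

section RegularRep

variable {k : Type} [Field k] {q : k} (hq : IsGeneric q)

theorem regularRep_one (l : ℤ) : regularRep hq (one 1 (qInt q) l) = proj k l := lift_one l

theorem regularRep_E (l : ℤ) :
    regularRep hq (E 1 (qInt q) l) = raise q * proj k (l - 2) :=
  (lift_E l).trans (proj_mul_raise l)

theorem regularRep_F (l : ℤ) :
    regularRep hq (F 1 (qInt q) l) = lower q * proj k (l + 2) :=
  (lift_F l).trans (proj_mul_lower l)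

theorem regularRep_EPowOne (l : ℤ) (a : ℕ) :
    regularRep hq (EPowOne 1 (qInt q) l a) = raise q ^ a * proj k l := by
  induction a with
  | zero => rw [EPowOne, regularRep_one, pow_zero, one_mul]
  | succ a ih =>
    rw [EPowOne, map_mul, ih, regularRep_E, add_sub_cancel_right, mul_assoc,
      ← proj_mul_raise_pow l a, ← mul_assoc (proj k _), proj_mul_proj, if_pos rfl,
      proj_mul_raise_pow, pow_succ', mul_assoc]

theorem regularRep_FPowOne (l : ℤ) (b : ℕ) :
    regularRep hq (FPowOne 1 (qInt q) l b) = lower q ^ b * proj k l := by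
  induction b with
  | zero => rw [FPowOne, regularRep_one, pow_zero, one_mul]
  | succ b ih =>
    rw [FPowOne, map_mul, ih, regularRep_F, sub_add_cancel, mul_assoc,
      ← proj_mul_lower_pow l b, ← mul_assoc (proj k _), proj_mul_proj, if_pos rfl,
      proj_mul_lower_pow, pow_succ', mul_assoc]

theorem regularRep_FE (b a : ℕ) (m : ℤ) :
    regularRep hq (FE 1 (qInt q) b a m) = lower q ^ b * raise q ^ a * proj k m := by
  rw [FE, map_mul, regularRep_FPowOne, regularRep_EPowOne, ← proj_mul_raise_pow, mul_assoc,
    ← mul_assoc (proj k _), proj_mul_proj, if_pos rfl, proj_mul_raise_pow, mul_assoc]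

theorem regularRep_EF (b a : ℕ) (m : ℤ) :
    regularRep hq (EF 1 (qInt q) b a m) = raise q ^ a * lower q ^ b * proj k m := by
  rw [EF, map_mul, regularRep_FPowOne, regularRep_EPowOne, ← proj_mul_lower_pow, mul_assoc,
    ← mul_assoc (proj k _), proj_mul_proj, if_pos rfl, proj_mul_lower_pow, mul_assoc]

theorem proj_vacuum (m m' : ℤ) :
    proj k m (e k 0 0 m') = if m = m' then e k 0 0 m' else 0 := by
  rw [proj_e]
  simp

theorem regularRep_FE_vacuum {b a : ℕ} {m : ℤ} (h : b ≤ a + m) (m' : ℤ) :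
    regularRep hq (FE 1 (qInt q) b a m) (e k 0 0 m') =
      if m = m' then (qFactorial q a * qFactorial q b) • e k b a m else 0 := by
  rw [regularRep_FE, Module.End.mul_apply, Module.End.mul_apply, proj_vacuum]
  split_ifs with hm
  · have := lower_pow_of_le (q := q) (b := 0) (a := a) (n := b) (m := m) (by simpa using h)
    rw [qFactorial_zero, one_smul, zero_add] at this
    rw [← hm, raise_pow_vacuum, map_smul, this, smul_smul]
  · rw [map_zero, map_zero]

theorem regularRep_EF_vacuum {b a : ℕ} {m : ℤ} (h : a + m ≤ b) (m' : ℤ) :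
    regularRep hq (EF 1 (qInt q) b a m) (e k 0 0 m') =
      if m = m' then (qFactorial q a * qFactorial q b) • e k b a m else 0 := by
  rw [regularRep_EF, Module.End.mul_apply, Module.End.mul_apply, proj_vacuum]
  split_ifs with hm
  · have := raise_pow_of_le (q := q) (b := b) (a := 0) (n := a) (m := m) (by simpa using h)
    rw [qFactorial_zero, one_smul, zero_add] at this
    rw [← hm, lower_pow_vacuum, map_smul, this, smul_smul, mul_comm]
  · rw [map_zero, map_zero]

/-- In either order of `E` and `F`, the path from the vacuum to `e b a m` stays where each step has
one term, and the factorials it collects cancel the normalization. -/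
theorem regularRep_canonicalElement_vacuum (b a : ℕ) (m m' : ℤ) :
    regularRep hq (canonicalElement q (b, a, m)) (e k 0 0 m') =
      if m = m' then e k b a m else 0 := by
  have hne : qFactorial q a * qFactorial q b ≠ 0 :=
    mul_ne_zero (hq.qFactorial_ne_zero _) (hq.qFactorial_ne_zero _)
  rw [canonicalElement, map_smul, LinearMap.smul_apply]
  have h : regularRep hq (if (b : ℤ) ≤ a + m then FE 1 (qInt q) b a m else EF 1 (qInt q) b a m)
      (e k 0 0 m') = if m = m' then (qFactorial q a * qFactorial q b) • e k b a m else 0 := by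
    split_ifs with h₁ h₂ h₂
    · rw [regularRep_FE_vacuum hq h₁, if_pos h₂]
    · rw [regularRep_FE_vacuum hq h₁, if_neg h₂]
    · rw [regularRep_EF_vacuum hq (by omega), if_pos h₂]
    · rw [regularRep_EF_vacuum hq (by omega), if_neg h₂]
  rw [h, smul_ite, smul_zero, inv_smul_smul₀ hne]

/-- The coefficient functionals of the canonical basis. -/
def canonicalCoeff (i : ℕ × ℕ × ℤ) : DotAlgebra (1 : k) (qInt q) →ₗ[k] k where
  toFun u := regularRep hq u (e k 0 0 i.2.2) i
  map_add' u w := by rw [map_add, LinearMap.add_apply, Finsupp.add_apply]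
  map_smul' d u := by rw [map_smul, LinearMap.smul_apply, Finsupp.smul_apply]; rfl

theorem canonicalCoeff_apply (i : ℕ × ℕ × ℤ) (u : DotAlgebra (1 : k) (qInt q)) :
    canonicalCoeff hq i u = regularRep hq u (e k 0 0 i.2.2) i := rfl

theorem canonicalCoeff_canonicalElement (i j : ℕ × ℕ × ℤ) :
    canonicalCoeff hq i (canonicalElement q j) = if j = i then 1 else 0 := by
  obtain ⟨b, a, m⟩ := i
  obtain ⟨b', a', m'⟩ := j
  rw [canonicalCoeff_apply, regularRep_canonicalElement_vacuum]
  split_ifs with h₁ h₂ h₂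
  · rw [e, h₂, Finsupp.single_eq_same]
  · rw [e, Finsupp.single_eq_of_ne (Ne.symm h₂)]
  · exact absurd (congrArg (fun i => i.2.2) h₂) h₁
  · rfl

theorem linearIndependent_canonicalElement (hq : IsGeneric q) :
    LinearIndependent k (canonicalElement q) := by
  rw [linearIndependent_iff']
  intro s g hg i hi
  have := congrArg (canonicalCoeff hq i) hg
  simpa [canonicalCoeff_canonicalElement, hi] using this

/-- The canonical basis of modified quantum `sl(2)`. -/
def canonicalElementBasis :
    Module.Basis (ℕ × ℕ × ℤ) k (DotAlgebra (1 : k) (qInt q)) :=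
  Module.Basis.mk (linearIndependent_canonicalElement hq) (span_canonicalElement hq).ge

theorem canonicalElementBasis_apply (i : ℕ × ℕ × ℤ) :
    canonicalElementBasis hq i = canonicalElement q i := Module.Basis.mk_apply _ _ _

/-- The vacuum functionals are dual to the canonical elements, so multiplication can be computed in
the representation. -/
theorem canonicalElementBasis_repr (u : DotAlgebra (1 : k) (qInt q)) (i : ℕ × ℕ × ℤ) :
    (canonicalElementBasis hq).repr u i = regularRep hq u (e k 0 0 i.2.2) i := by
  have : (canonicalElementBasis hq).coord i = canonicalCoeff hq i := by
    refine (canonicalElementBasis hq).ext fun j => ?_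
    rw [Module.Basis.coord_apply, Module.Basis.repr_self, canonicalElementBasis_apply,
      canonicalCoeff_canonicalElement, Finsupp.single_apply]
  exact DFunLike.congr_fun this u

theorem smul_FE_eq_canonicalElement {b a : ℕ} {m : ℤ} (h : b ≤ a + m) :
    (qFactorial q a * qFactorial q b)⁻¹ • FE 1 (qInt q) b a m = canonicalElement q (b, a, m) := by
  rw [canonicalElement, if_pos h]

/-- The content is the wall `a + m = b`, where `canonicalElement` is defined by the other ordering.
Both orderings act alike on every vacuum, hence coincide. -/
theorem smul_EF_eq_canonicalElement (hq : IsGeneric q) {b a : ℕ} {m : ℤ} (h : a + m ≤ b) :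
    (qFactorial q a * qFactorial q b)⁻¹ • EF 1 (qInt q) b a m = canonicalElement q (b, a, m) := by
  have hne : qFactorial q a * qFactorial q b ≠ 0 :=
    mul_ne_zero (hq.qFactorial_ne_zero _) (hq.qFactorial_ne_zero _)
  refine (canonicalElementBasis hq).repr.injective (Finsupp.ext fun i => ?_)
  rw [canonicalElementBasis_repr, canonicalElementBasis_repr, regularRep_canonicalElement_vacuum,
    map_smul, LinearMap.smul_apply, regularRep_EF_vacuum hq h, smul_ite, smul_zero,
    inv_smul_smul₀ hne]

end RegularRep

namespace CanonicalModule

variable {k : Type} [Field k] {q : k}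

/-! ### Positivity -/

/-- The vectors whose coordinates lie in `ℕ[q, q⁻¹]`. -/
def positiveCone (q : k) : AddSubmonoid (CanonicalModule k) where
  carrier := {w | ∀ i, w i ∈ Subsemiring.closure {q, q⁻¹}}
  zero_mem' _ := zero_mem _
  add_mem' hx hy i := add_mem (hx i) (hy i)

theorem smul_mem_positiveCone {d : k} {w : CanonicalModule k}
    (hd : d ∈ Subsemiring.closure {q, q⁻¹}) (hw : w ∈ positiveCone q) :
    d • w ∈ positiveCone q := fun i => mul_mem hd (hw i)

theorem e_mem_positiveCone (b a : ℕ) (m : ℤ) : e k b a m ∈ positiveCone q := fun i => by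
  rw [e, Finsupp.single_apply]
  split_ifs
  · exact one_mem _
  · exact zero_mem _

theorem map_mem_positiveCone {f : Module.End k (CanonicalModule k)}
    (hf : ∀ b a m, f (e k b a m) ∈ positiveCone q) {w : CanonicalModule k}
    (hw : w ∈ positiveCone q) : f w ∈ positiveCone q := by
  have h : w = ∑ i ∈ w.support, w i • e k i.1 i.2.1 i.2.2 := by
    conv_lhs => rw [← Finsupp.sum_single w]
    simp [Finsupp.sum, e]
  rw [h, map_sum]
  refine sum_mem fun i _ => ?_
  rw [map_smul]
  exact smul_mem_positiveCone (hw i) (hf _ _ _)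

/-- The vector `e (b - j) (a + n - j) m`, or zero if `j > b`. -/
def shifted (k : Type) [Field k] (b a : ℕ) (m : ℤ) (n j : ℕ) : CanonicalModule k :=
  if j ≤ b then e k (b - j) (a + n - j) m else 0

theorem shifted_mem_positiveCone (b a : ℕ) (m : ℤ) (n j : ℕ) :
    shifted k b a m n j ∈ positiveCone q := by
  rw [shifted]
  split_ifs
  · exact e_mem_positiveCone _ _ _
  · exact zero_mem _

theorem raise_shifted {b a n j : ℕ} {m : ℤ} {x : ℕ} (hx : a + m = b + x) (hj : j ≤ n) :
    raise q (shifted k b a m n j) = qInt q (a + n - j + 1) • shifted k b a m (n + 1) j +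
      qInt q (x + a + 2 * n - j + 1) • shifted k b a m (n + 1) (j + 1) := by
  obtain ⟨i, rfl⟩ := Nat.exists_eq_add_of_le hj
  rw [shifted, shifted, shifted]
  rcases lt_trichotomy j b with h | rfl | h
  · obtain ⟨d, rfl⟩ := Nat.exists_eq_add_of_lt h
    rw [if_pos (by omega), if_pos (by omega), if_pos (by omega),
      show j + d + 1 - j = d + 1 by omega, show a + (j + i) - j = a + i by omega,
      show a + (j + i + 1) - j = a + i + 1 by omega, show j + d + 1 - (j + 1) = d by omega,
      show a + (j + i + 1) - (j + 1) = a + i by omega, raise_succ,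
      if_pos (by push_cast at *; omega)]
    congr 3
    · push_cast; ring
    · push_cast at *; linarith
  · rw [if_pos le_rfl, if_pos le_rfl, if_neg (by omega), smul_zero, add_zero, Nat.sub_self,
      raise_zero, show a + (j + i) - j = a + i by omega,
      show a + (j + i + 1) - j = a + i + 1 by omega]
    congr 2
    push_cast; ring
  · rw [if_neg (by omega), if_neg (by omega), if_neg (by omega), map_zero, smul_zero, smul_zero,
      add_zero]

/-- The coefficient recursion behind `raise_pow_of_ge`: the left side is the new coefficient times
`[n + 1]`, and the right side collects the two sources of the same vector. After multiplication by
`[j + 1]` it reduces to `qInt_mul_qInt`. -/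
theorem raise_pow_coeff (hq : IsGeneric q) (N a i j : ℕ) :
    qInt q (i + j + 1) * (gaussBinom q (N + 1) (j + 1) * gaussBinom q (a + i) a) =
      gaussBinom q N (j + 1) * gaussBinom q (a + i - 1) a * qInt q (a + i) +
        gaussBinom q N j * gaussBinom q (a + i) a * qInt q (N + i + 1) := by
  -- At `i = 0` both sides vanish: for `a = 0` through `[0] = 0`, for `a > 0` through the binomial
  -- with lower index `a` exceeding `a - 1`.
  have h₁ : gaussBinom q (a + i - 1) a * qInt q (a + i) =
      qInt q i * gaussBinom q (a + i) a := by
    cases i with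
    | zero =>
      cases a with
      | zero => simp
      | succ a => rw [gaussBinom_eq_zero (by omega)]; simp
    | succ i =>
      have := hq.gaussBinom_succ_left i a
      rw [← Nat.add_assoc, Nat.add_sub_cancel, add_comm a i]
      push_cast
      rw [this, mul_comm, show (a : ℤ) + (i + 1) = i + a + 1 by ring]
  have h₂ := hq.gaussBinom_succ_right N j
  have h₃ := hq.gaussBinom_succ_succ_mul N j
  have h₄ := hq.qInt_mul_qInt (N + 1) (i + j + 1) (j + 1)
  rw [show (N : ℤ) + 1 - (j + 1) = N - j by ring, show (i : ℤ) + j + 1 - (j + 1) = i by ring,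
    show (N : ℤ) + 1 + (i + j + 1) - (j + 1) = N + i + 1 by ring] at h₄
  refine mul_left_cancel₀ (hq.qInt_succ_ne_zero j) ?_
  linear_combination (-qInt q (j + 1) * gaussBinom q N (j + 1)) * h₁ +
    (-qInt q i * gaussBinom q (a + i) a) * h₂ +
    (qInt q (i + j + 1) * gaussBinom q (a + i) a) * h₃ +
    (gaussBinom q N j * gaussBinom q (a + i) a) * h₄

/-- This is the commutation formula for `E^{(n)} F^{(b)}`, followed by merging `E^{(n-j)} E^{(a)}`
into a binomial multiple of `E^{(a+n-j)}`. The region `b ≤ a + m` is stable under raising, so one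
formula covers all `n`. -/
theorem raise_pow_of_ge (hq : IsGeneric q) {b a x : ℕ} {m : ℤ} (hx : a + m = b + x) (n : ℕ) :
    (raise q ^ n) (e k b a m) = qFactorial q n • ∑ j ∈ Finset.range (n + 1),
      (gaussBinom q (n + x + a) j * gaussBinom q (a + n - j) a) • shifted k b a m n j := by
  induction n with
  | zero => simp [shifted]
  | succ n ih =>
    rw [pow_succ', Module.End.mul_apply, ih, map_smul, map_sum, qFactorial_succ, ← smul_smul]
    congr 1
    have h₁ : ∀ j ∈ Finset.range (n + 1),
        raise q ((gaussBinom q (n + x + a) j * gaussBinom q (a + n - j) a) •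
          shifted k b a m n j) =
        (gaussBinom q (n + x + a) j * gaussBinom q (a + n - j) a * qInt q (a + n - j + 1)) •
            shifted k b a m (n + 1) j +
          (gaussBinom q (n + x + a) j * gaussBinom q (a + n - j) a *
            qInt q (x + a + 2 * n - j + 1)) • shifted k b a m (n + 1) (j + 1) := fun j hj => by
      rw [map_smul, raise_shifted hx (Finset.mem_range_succ_iff.1 hj), smul_add, smul_smul,
        smul_smul]
    -- A vanishing term `j = n + 1` is added so that both sums run over the same range after the
    -- shift. For `a = 0` the truncated subtraction leaves the binomial equal to `1`, and `[0]`
    -- kills the term instead.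
    have h₂ : (gaussBinom q (n + x + a) (n + 1) * gaussBinom q (a + n - (n + 1)) a *
        qInt q (a + n - (n + 1 : ℕ) + 1)) • shifted k b a m (n + 1) (n + 1) = 0 := by
      cases a with
      | zero => simp
      | succ a => rw [gaussBinom_eq_zero (n := a + 1 + n - (n + 1)) (by omega)]; simp
    rw [Finset.sum_congr rfl h₁, Finset.sum_add_distrib,
      ← add_zero (Finset.sum _ fun j => _ • shifted k b a m (n + 1) j), ← h₂,
      ← Finset.sum_range_succ (fun j => (gaussBinom q (n + x + a) j * gaussBinom q (a + n - j) a *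
        qInt q (a + n - j + 1)) • shifted k b a m (n + 1) j) (n + 1),
      Finset.sum_range_succ' _ (n + 1), Finset.sum_range_succ' _ (n + 1), smul_add,
      Finset.smul_sum, add_right_comm,
      ← Finset.sum_add_distrib]
    congr 1
    · refine Finset.sum_congr rfl fun j hj => ?_
      obtain ⟨i, rfl⟩ := Nat.exists_eq_add_of_le (Finset.mem_range_succ_iff.1 hj)
      have key := raise_pow_coeff hq (j + i + x + a) a i j
      rw [smul_smul, ← add_smul]
      congr 1
      rw [show j + i + 1 + x + a = j + i + x + a + 1 by ring,
        show a + (j + i + 1) - (j + 1) = a + i by omega,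
        show a + (j + i) - (j + 1) = a + i - 1 by omega,
        show a + (j + i) - j = a + i by omega]
      push_cast at key ⊢
      rw [show (a : ℤ) + (j + i) - (j + 1) + 1 = a + i by ring,
        show (x : ℤ) + a + 2 * (j + i) - j + 1 = j + i + x + a + i + 1 by ring,
        show (j : ℤ) + i + 1 = i + j + 1 by ring]
      exact key.symm
    · rw [smul_smul]
      congr 1
      have := hq.gaussBinom_succ_left n a
      rw [gaussBinom_zero_right, gaussBinom_zero_right, Nat.sub_zero, Nat.sub_zero, one_mul,
        one_mul, show a + (n + 1) = n + a + 1 by ring, this, mul_comm, add_comm a n]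
      push_cast
      rw [show (a : ℤ) + n - 0 + 1 = n + a + 1 by ring]

/-- Needed when a power of `E` crosses the wall: it turns the ratio of factorials left by splitting
the power in two back into Gaussian binomials. Both sides are the same quotient of factorials. -/
theorem raise_divPow_coeff (hq : IsGeneric q) (a y i j : ℕ) :
    qFactorial q (a + y) * qFactorial q (i + j) *
      (gaussBinom q (i + j + (a + y)) j * gaussBinom q (a + y + i) (a + y)) =
    qFactorial q a * qFactorial q (i + j + y) *
      (gaussBinom q (i + j + y + a) a * gaussBinom q (i + j) j) := by
  have h₁ := hq.gaussBinom_eq_div (i + (a + y)) j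
  have h₂ := hq.gaussBinom_eq_div i (a + y)
  rw [show i + (a + y) + j = i + j + (a + y) by ring] at h₁
  rw [hq.gaussBinom_eq_div (i + j + y) a, hq.gaussBinom_eq_div i j, h₁, add_comm (a + y) i, h₂,
    show i + j + y + a = i + j + (a + y) by ring]
  have := hq.qFactorial_ne_zero
  have h₃ := this (a + y)
  have h₄ := this (i + j)
  have h₅ := this a
  have h₆ := this (i + j + y)
  have h₇ := this i
  have h₈ := this j
  have h₉ := this (i + (a + y))
  field_simp

/-- On basis vectors there are three cases: starting at or beyond the wall in `b ≤ a + m`, stopping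
no later than the wall, or crossing it. Each gives coefficients that are products of Gaussian
binomials. -/
theorem raise_divPow_mem (hq : IsGeneric q) (n : ℕ) {w : CanonicalModule k}
    (hw : w ∈ positiveCone q) :
    ((qFactorial q n)⁻¹ • raise q ^ n) w ∈ positiveCone q := by
  refine map_mem_positiveCone (fun b a m => ?_) hw
  have hn := hq.qFactorial_ne_zero n
  have ha := hq.qFactorial_ne_zero a
  rw [LinearMap.smul_apply]
  rcases le_total (b : ℤ) (a + m) with h | h
  · obtain ⟨x, hx⟩ := Int.le.dest h
    rw [raise_pow_of_ge hq hx.symm, inv_smul_smul₀ hn]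
    exact sum_mem fun j _ => smul_mem_positiveCone
      (mul_mem (gaussBinom_mem _ _) (gaussBinom_mem _ _)) (shifted_mem_positiveCone _ _ _ _ _)
  · obtain ⟨y, hy⟩ := Int.le.dest h
    rcases le_total n y with hny | hny
    · have h₁ := raise_pow_of_le (k := k) (q := q) (b := b) (a := a) (n := n) (m := m) (by omega)
      have h₂ : (qFactorial q n)⁻¹ • (raise q ^ n) (e k b a m) =
          gaussBinom q (n + a) a • e k b (a + n) m := by
        rw [← inv_smul_smul₀ ha ((raise q ^ n) (e k b a m)), h₁, smul_smul, smul_smul,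
          hq.gaussBinom_eq_div, add_comm a n]
        congr 1
        field_simp
      rw [h₂]
      exact smul_mem_positiveCone (gaussBinom_mem _ _) (e_mem_positiveCone _ _ _)
    -- The first `y` steps reach the wall, with one term each; the remaining `c` steps start there,
    -- so the general formula applies with `x = 0`.
    · obtain ⟨c, rfl⟩ := Nat.exists_eq_add_of_le' hny
      have h₁ := raise_pow_of_le (k := k) (q := q) (b := b) (a := a) (n := y) (m := m) (by omega)
      have h₂ : (qFactorial q (c + y))⁻¹ • (raise q ^ (c + y)) (e k b a m) =
          ∑ j ∈ Finset.range (c + 1), (gaussBinom q (c + y + a) a * gaussBinom q c j) •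
            shifted k b (a + y) m c j := by
        rw [pow_add, Module.End.mul_apply, ← inv_smul_smul₀ ha ((raise q ^ y) (e k b a m)), h₁,
          map_smul, map_smul, raise_pow_of_ge hq (x := 0) (by push_cast; omega), smul_smul,
          smul_smul, smul_smul, Finset.smul_sum]
        refine Finset.sum_congr rfl fun j hj => ?_
        obtain ⟨i, rfl⟩ := Nat.exists_eq_add_of_le' (Finset.mem_range_succ_iff.1 hj)
        rw [smul_smul]
        congr 1
        have key := raise_divPow_coeff hq a y i j
        rw [add_zero, show a + y + (i + j) - j = a + y + i by omega]
        field_simp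
        linear_combination key
      rw [h₂]
      exact sum_mem fun j _ => smul_mem_positiveCone
        (mul_mem (gaussBinom_mem _ _) (gaussBinom_mem _ _)) (shifted_mem_positiveCone _ _ _ _ _)

theorem flip_mem {w : CanonicalModule k} (hw : w ∈ positiveCone q) :
    flip k w ∈ positiveCone q :=
  map_mem_positiveCone (fun b a m => by rw [flip_e]; exact e_mem_positiveCone _ _ _) hw

theorem proj_mem (l : ℤ) {w : CanonicalModule k} (hw : w ∈ positiveCone q) :
    proj k l w ∈ positiveCone q :=
  map_mem_positiveCone (fun b a m => by
    rw [proj_e]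
    split_ifs
    · exact e_mem_positiveCone _ _ _
    · exact zero_mem _) hw

theorem lower_divPow_mem (hq : IsGeneric q) (n : ℕ) {w : CanonicalModule k}
    (hw : w ∈ positiveCone q) :
    ((qFactorial q n)⁻¹ • lower q ^ n) w ∈ positiveCone q := by
  have := flip_mem (raise_divPow_mem hq n (flip_mem hw))
  rw [LinearMap.smul_apply, map_smul] at this
  rwa [LinearMap.smul_apply, lower_pow]

end CanonicalModule

/-! ### Positivity of the structure constants -/

section StructureConstants

variable {k : Type} [Field k] {q : k} (hq : IsGeneric q)

theorem regularRep_canonicalElement_mem (i : ℕ × ℕ × ℤ) {w : CanonicalModule k}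
    (hw : w ∈ positiveCone q) : regularRep hq (canonicalElement q i) w ∈ positiveCone q := by
  obtain ⟨b, a, m⟩ := i
  rw [canonicalElement, map_smul, mul_inv]
  split_ifs
  · have := lower_divPow_mem hq b (raise_divPow_mem hq a (proj_mem m hw))
    rw [regularRep_FE]
    rwa [LinearMap.smul_apply, LinearMap.smul_apply, map_smul, smul_smul, mul_comm] at this
  · have := raise_divPow_mem hq a (lower_divPow_mem hq b (proj_mem m hw))
    rw [regularRep_EF]
    rwa [LinearMap.smul_apply, LinearMap.smul_apply, map_smul, smul_smul] at this

/-- The right factor sends the vacuum to a basis vector or zero, and the left factor preserves the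
positive cone. -/
theorem canonicalElementBasis_repr_mul_mem (i j l : ℕ × ℕ × ℤ) :
    (canonicalElementBasis hq).repr (canonicalElement q i * canonicalElement q j) l ∈
      Subsemiring.closure {q, q⁻¹} := by
  rw [canonicalElementBasis_repr, map_mul, Module.End.mul_apply]
  refine regularRep_canonicalElement_mem hq i ?_ l
  obtain ⟨b, a, m⟩ := j
  rw [regularRep_canonicalElement_vacuum]
  split_ifs
  · exact e_mem_positiveCone _ _ _
  · exact zero_mem _

end StructureConstants

/-! ### The ground field -/

theorem isGeneric_v : IsGeneric v where
  ne_zero := RatFunc.X_ne_zero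
  pow_ne_one n h := by
    have h' : (RatFunc.X : RatFunc Qt) ^ (n + 1) = 1 := h
    rw [← RatFunc.algebraMap_X, ← map_pow, ← map_one (algebraMap (Polynomial Qt) (RatFunc Qt))] at h'
    have := congrArg Polynomial.natDegree (RatFunc.algebraMap_injective Qt h')
    rw [Polynomial.natDegree_X_pow, Polynomial.natDegree_one] at this
    omega

theorem t_sq : t ^ 2 = -1 := by
  have h : (AdjoinRoot.root (Polynomial.X ^ 2 + 1 : Polynomial ℚ)) ^ 2 + 1 = 0 := by
    have := AdjoinRoot.eval₂_root (Polynomial.X ^ 2 + 1 : Polynomial ℚ)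
    simpa using this
  have h' := congrArg (RatFunc.C : Qt →+* RatFunc Qt) h
  rw [map_add, map_pow, map_one, map_zero] at h'
  exact eq_neg_of_add_eq_zero_left h'

theorem t_ne_zero : t ≠ 0 := fun h => by
  have := t_sq
  rw [h] at this
  norm_num at this

theorem t_zpow_four_mul (n : ℤ) : t ^ (4 * n) = 1 := by
  have h : t ^ (4 : ℤ) = 1 := by
    rw [show (4 : ℤ) = 2 * 2 by norm_num, zpow_mul]
    have : t ^ (2 : ℤ) = -1 := t_sq
    rw [this]
    norm_num
  rw [zpow_mul, h, one_zpow]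

theorem p_add_two (l : ℤ) : p (l + 2) = p l := by
  have : Even (l + 2) ↔ Even l := by
    rw [Int.even_add]
    simp
  simp only [p, this]

/-! ### Isomorphisms between the modified algebras -/

/-- The isomorphism from modified quantum `sl(2)` to modified quantum `osp(1|2)`. -/
def slToOsp : USl →ₙₐ[Qtv] UOsp :=
  DotAlgebra.rescale (fun l => t ^ (l + p l))
    (fun l => by
      rw [p_add_two, one_mul, show l + 2 + p l = l + p l + 2 by ring, zpow_add₀ t_ne_zero]
      rfl)
    (fun l => by
      rw [cOsp, ← mul_assoc, ← zpow_add₀ t_ne_zero, show l + p l + (-l - p l) = 0 by ring,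
        zpow_zero, one_mul, cSl])

theorem isRescaling_slToOsp : IsRescaling slToOsp := fun l =>
  ⟨DotAlgebra.rescale_E l, DotAlgebra.rescale_F l, DotAlgebra.rescale_one l⟩

theorem slToOsp_bijective : Function.Bijective slToOsp :=
  DotAlgebra.rescale_bijective fun _ => zpow_ne_zero _ t_ne_zero

theorem IsRescaling.eq_slToOsp {ψ : USl →ₙₐ[Qtv] UOsp} (hψ : IsRescaling ψ) : ψ = slToOsp :=
  DotAlgebra.hom_ext (fun l => (hψ l).2.2.trans (isRescaling_slToOsp l).2.2.symm)
    (fun l => (hψ l).1.trans (isRescaling_slToOsp l).1.symm)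
    (fun l => (hψ l).2.1.trans (isRescaling_slToOsp l).2.1.symm)

/-- Since `t⁻¹ = -t`, one has `π q = v t` and `q⁻¹ = v⁻¹ t`; a factor `t ^ l` comes out of the
numerator and `t` out of the denominator. -/
theorem qpiInt_eq (l : ℤ) : qpiInt (v * t⁻¹) (-1) l = t ^ (l - 1) * qInt v l := by
  have ht := t_ne_zero
  have hinv : t⁻¹ = -t := inv_eq_of_mul_eq_one_right (by linear_combination -t_sq)
  have h₁ : -1 * (v * t⁻¹) = v * t := by rw [hinv]; ring
  have h₂ : (v * t⁻¹) ^ (-l) = v ^ (-l) * t ^ l := by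
    rw [mul_zpow, inv_zpow', neg_neg]
  have h₃ : (v * t⁻¹)⁻¹ = v⁻¹ * t := by rw [mul_inv, inv_inv]
  rw [qpiInt, qInt, h₁, h₂, h₃, mul_zpow, zpow_sub_one₀ ht, ← sub_mul, ← sub_mul]
  have := isGeneric_v.sub_inv_ne_zero
  rw [mul_div_mul_comm, div_eq_mul_inv (t ^ l)]
  ring

/-- The isomorphism from modified quantum `osp(1|2)` to Clark and Wang's version of it. -/
def ospToClarkWang : UOsp →ₙₐ[Qtv] UClarkWang :=
  -- The exponent is forced by the scalars: `(-l - p l) - (l - 1)`. The sign condition then holds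
  -- because `t ^ 4 = 1`.
  DotAlgebra.rescale (fun l => t ^ (1 - 2 * l - p l))
    (fun l => by
      rw [p_add_two, show 1 - 2 * (l + 2) - p l = 1 - 2 * l - p l + 4 * (-1) by ring,
        zpow_add₀ t_ne_zero, t_zpow_four_mul, t_sq]
      ring)
    (fun l => by
      rw [qpiInt_eq, cOsp, ← mul_assoc, ← zpow_add₀ t_ne_zero]
      congr 2
      ring)

theorem ospToClarkWang_bijective : Function.Bijective ospToClarkWang :=
  DotAlgebra.rescale_bijective fun _ => zpow_ne_zero _ t_ne_zero

/-! ### The canonical basis -/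

open DotAlgebra

/-- The middle weight gives the dictionary: `n = m + 2 * a` for `F^{(b)} 1_n E^{(a)}` and `-n = m -
2 * b` for `E^{(a)} 1_{-n} F^{(b)}`. Either way `a + b ≤ n` becomes the condition on the triple. -/
theorem range_canonicalElement : Set.range (canonicalElement v) = canonicalBasis := by
  ext x
  constructor
  · rintro ⟨⟨b, a, m⟩, rfl⟩
    rcases le_total (b : ℤ) (a + m) with h | h
    · obtain ⟨n, hn⟩ := Int.eq_ofNat_of_zero_le (show 0 ≤ m + 2 * a by omega)
      refine ⟨a, b, n, by omega, Or.inr ?_⟩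
      rw [← smul_FE_eq_canonicalElement h, oneEPow_eq, FE, hn,
        show (n : ℤ) - 2 * a = m by omega]
      rfl
    · obtain ⟨n, hn⟩ := Int.eq_ofNat_of_zero_le (show 0 ≤ 2 * b - m by omega)
      refine ⟨a, b, n, by omega, Or.inl ?_⟩
      rw [← smul_EF_eq_canonicalElement isGeneric_v h, oneFPow_eq, EF,
        show m - 2 * b = -(n : ℤ) by omega, show -(n : ℤ) + 2 * b = m by omega]
      rfl
  · rintro ⟨a, b, n, hn, rfl | rfl⟩
    · refine ⟨(b, a, -n + 2 * b), ?_⟩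
      rw [← smul_EF_eq_canonicalElement isGeneric_v (by omega), EF, oneFPow_eq,
        show -(n : ℤ) + 2 * b - 2 * b = -n by ring]
      rfl
    · refine ⟨(b, a, n - 2 * a), ?_⟩
      rw [← smul_FE_eq_canonicalElement (by omega), FE, oneEPow_eq,
        show (n : ℤ) - 2 * a + 2 * a = n by ring]
      rfl

/-- The canonical basis of `USl`, indexed by leading terms. -/
def slBasis : Module.Basis (ℕ × ℕ × ℤ) Qtv USl := canonicalElementBasis isGeneric_v

theorem range_slBasis : Set.range slBasis = canonicalBasis :=
  (congrArg Set.range (funext (canonicalElementBasis_apply isGeneric_v))).trans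
    range_canonicalElement

theorem slBasis_repr_mul_mem (i j l : ℕ × ℕ × ℤ) :
    slBasis.repr (slBasis i * slBasis j) l ∈ natLaurent := by
  have h := canonicalElementBasis_repr_mul_mem isGeneric_v i j l
  rw [← canonicalElementBasis_apply isGeneric_v, ← canonicalElementBasis_apply isGeneric_v] at h
  exact h

/-- The isomorphism `slToOsp`, as a linear equivalence. -/
def slToOspEquiv : USl ≃ₗ[Qtv] UOsp :=
  LinearEquiv.ofBijective (slToOsp : USl →ₗ[Qtv] UOsp) slToOsp_bijective

theorem slToOspEquiv_apply (x : USl) : slToOspEquiv x = slToOsp x := rfl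

/-- The canonical basis of modified quantum `osp(1|2)`. -/
def ospBasis : Module.Basis (ℕ × ℕ × ℤ) Qtv UOsp := slBasis.map slToOspEquiv

theorem ospBasis_apply (i : ℕ × ℕ × ℤ) : ospBasis i = slToOsp (slBasis i) := by
  rw [ospBasis, Module.Basis.map_apply, slToOspEquiv_apply]

theorem range_ospBasis : Set.range ospBasis = slToOsp '' canonicalBasis := by
  rw [← range_slBasis, ← Set.range_comp]
  exact congrArg Set.range (funext ospBasis_apply)

theorem ospBasis_repr_mul_mem (i j l : ℕ × ℕ × ℤ) :
    ospBasis.repr (ospBasis i * ospBasis j) l ∈ natLaurent := by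
  have h : slToOspEquiv.symm (ospBasis i * ospBasis j) = slBasis i * slBasis j := by
    rw [LinearEquiv.symm_apply_eq, ospBasis_apply, ospBasis_apply, ← map_mul, slToOspEquiv_apply]
  have h' : ospBasis.repr (ospBasis i * ospBasis j) =
      slBasis.repr (slToOspEquiv.symm (ospBasis i * ospBasis j)) := by
    conv_lhs => rw [ospBasis, Module.Basis.map_repr, LinearEquiv.trans_apply]
    rfl
  rw [h', h]
  exact slBasis_repr_mul_mem i j l

end ModifiedQuantum

end

open ModifiedQuantum in
theorem theorem5 :
    ∃ φ : USl →ₙₐ[Qtv] UOsp,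
      (IsRescaling φ ∧ Function.Bijective φ ∧ ∀ ψ : USl →ₙₐ[Qtv] UOsp, IsRescaling ψ → ψ = φ) ∧
      (∃ θ : UOsp →ₙₐ[Qtv] UClarkWang, Function.Bijective θ) ∧
      (∃ B : Module.Basis (φ '' canonicalBasis) Qtv UOsp,
        (∀ x, B x = (x : UOsp)) ∧
        ∀ x y z, B.repr (B x * B y) z ∈ natLaurent) := by
  refine ⟨slToOsp, ⟨isRescaling_slToOsp, slToOsp_bijective, fun ψ hψ => hψ.eq_slToOsp⟩,
    ⟨ospToClarkWang, ospToClarkWang_bijective⟩, ?_⟩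
  -- The basis is to be indexed by the set itself, where the overlap `n = a + b` counts once. The
  -- triples already list each element once, so reindexing by the range suffices.
  rw [← range_ospBasis]
  refine ⟨ospBasis.reindexRange, ospBasis.reindexRange_apply, ?_⟩
  rintro ⟨_, i, rfl⟩ ⟨_, j, rfl⟩ ⟨_, l, rfl⟩
  rw [Module.Basis.reindexRange_repr, Module.Basis.reindexRange_apply,
    Module.Basis.reindexRange_apply]
  exact ospBasis_repr_mul_mem i j l
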